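/- Let $N\ge 1$, write $B_r=\{x\in\mathbb{R}^N:|x|<r\}$, $B_r(x)=x+B_r$, $\mathbb{R}^N_+=\{x\in\mathbb{R}^N: x_1>0\}$ and $B_2^+=B_2\cap\mathbb{R}^N_+$. Let $\ell(0)=0$ and $\ell(r)=-1/\ln(\min\{0.1,r\})$ for $r>0$. Let $\mathcal L^{1/2}(\mathbb{R}^N)$ be the space of functions $u:\mathbb{R}^N\to\mathbb{R}$ with $$\|u\|_{L^\infty(\mathbb{R}^N)}+\sup_{x\ne y}\frac{|u(x)-u(y)|}{\ell^{1/2}(|x-y|)}<\infty ,$$ and let $\mathbb{H}(B_2^+)$ be the space of $u\in L^2(\mathbb{R}^N)$ with $u=0$ (a.e.) in $\mathbb{R}^N\setminus B_2^+$ and $$\iint_{|x-y|\le 1}\frac{|u(x)-u(y)|^2}{|x-y|^N}\,dx\,dy<\infty .$$ The logarithmic Laplacian is $$L_\Delta u(x)=c_N\int_{B_1(x)}\frac{u(x)-u(y)}{|x-y|^N}\,dy-c_N\int_{\mathbb{R}^N\setminus B_1(x)}\frac{u(y)}{|x-y|^N}\,dy+\rho_N u(x),$$ where $c_N=\pi^{-N/2}\Gamma(N/2)$,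 $\rho_N=2\ln 2+\frac{\Gamma'(N/2)}{\Gamma(N/2)}-\gamma$ and $\gamma=-\Gamma'(1)$. **Theorem.** There is a function $w\in\mathcal L^{1/2}(\mathbb{R}^N)\cap C^\infty(\mathbb{R}^N\setminus\partial\mathbb{R}^N_+)\cap\mathbb{H}(B_2^+)$ such that $w=0$ in $\mathbb{R}^N\setminus B_2^+$, the integrals defining $L_\Delta w(x)$ converge absolutely for every $x\in B_2^+$, and $L_\Delta w\in L^\infty(B_2^+)$. Moreover, there are $c>0$ and $\delta>0$ such that $$c\,\ell^{1/2}(x_1)<w(x)<c^{-1}\ell^{1/2}(x_1)\quad\text{and}\quad L_\Delta w(x)>c\qquad\text{for all }x\in B_2^+\cap B_\delta .$$ The function $w$ can be taken of the form $w(x)=\chi(x)\,\bigl(-\ln\frac{x_1}{2}\bigr)^{-1/2}$ for $0<x_1<2$ and $w(x)=0$ otherwise, where $\chi\in C_c^\infty(B_2)$, $0\le\chi\le1$, and $\chi=1$ in a neighbourhood of the origin. -/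

import Mathlib

open MeasureTheory Filter Topology
open scoped ContDiff

noncomputable section

namespace LogLaplacian

/-- `ℓ(r) = -1 / ln (min {0.1, r})` for `r ≥ 0`, with `ℓ(0) = 0` (here `Real.log 0 = 0`). -/
def ell (r : ℝ) : ℝ := -1 / Real.log (min (1 / 10) r)

/-- The constant `c_N = π^(-N/2) Γ(N/2)`. -/
def kernelConst (N : ℕ) : ℝ := Real.pi ^ (-((N : ℝ) / 2)) * Real.Gamma ((N : ℝ) / 2)

/-- The digamma function `Ψ = Γ' / Γ`. -/
def digamma (t : ℝ) : ℝ := deriv Real.Gamma t / Real.Gamma t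

/-- The constant `ρ_N = 2 ln 2 + Ψ(N/2) - γ`, where `γ = -Γ'(1)`. -/
def zeroOrderConst (N : ℕ) : ℝ :=
  2 * Real.log 2 + digamma ((N : ℝ) / 2) - (-deriv Real.Gamma 1)

/-- The space `𝓛^α(Ω)` of `α`-log-Hölder functions:
`‖u‖_{L^∞(Ω)} + sup_{x ≠ y} |u x - u y| / ℓ(|x - y|)^α < ∞`. -/
def LogHolder {N : ℕ} (α : ℝ) (Ω : Set (EuclideanSpace ℝ (Fin N)))
    (u : EuclideanSpace ℝ (Fin N) → ℝ) : Prop :=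
  MemLp u ⊤ (volume.restrict Ω) ∧
    ∃ C : ℝ, ∀ x ∈ Ω, ∀ y ∈ Ω, x ≠ y → |u x - u y| / ell ‖x - y‖ ^ α ≤ C

/-- The space `ℍ(Ω)`: functions in `L²(ℝ^N)` that vanish (almost everywhere) outside `Ω` and
for which the integral of `|u x - u y|² / |x - y|^N` over `|x - y| ≤ 1` is finite. -/
def MemH {N : ℕ} (Ω : Set (EuclideanSpace ℝ (Fin N)))
    (u : EuclideanSpace ℝ (Fin N) → ℝ) : Prop :=
  MemLp u 2 volume ∧
    (∫⁻ x : EuclideanSpace ℝ (Fin N), ∫⁻ y in Metric.closedBall x 1,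
      ENNReal.ofReal (|u x - u y| ^ 2 / ‖x - y‖ ^ N)) < ⊤ ∧
    ∀ᵐ x : EuclideanSpace ℝ (Fin N), x ∉ Ω → u x = 0

/-- The two integrals in the definition of `L_Δ u(x)` converge absolutely. -/
def LogLapConverges {N : ℕ} (u : EuclideanSpace ℝ (Fin N) → ℝ)
    (x : EuclideanSpace ℝ (Fin N)) : Prop :=
  IntegrableOn (fun y => (u x - u y) / ‖x - y‖ ^ N) (Metric.ball x 1) ∧
    IntegrableOn (fun y => u y / ‖x - y‖ ^ N) (Metric.ball x 1)ᶜ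

/-- The logarithmic Laplacian `L_Δ u(x)`, pointwise, by its integral representation
(meaningful where `LogLapConverges u x` holds). -/
def logLap {N : ℕ} (u : EuclideanSpace ℝ (Fin N) → ℝ) (x : EuclideanSpace ℝ (Fin N)) : ℝ :=
  kernelConst N * (∫ y in Metric.ball x 1, (u x - u y) / ‖x - y‖ ^ N)
    - kernelConst N * (∫ y in (Metric.ball x 1)ᶜ, u y / ‖x - y‖ ^ N)
    + zeroOrderConst N * u x

/-- The half ball `B_2^+ = {x : |x| < 2, x₁ > 0}`; the first coordinate `x₁` is `x 0`. -/
def halfBall (N : ℕ) [NeZero N] : Set (EuclideanSpace ℝ (Fin N)) :=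
  Metric.ball 0 2 ∩ {x | 0 < x 0}

end LogLaplacian

end

noncomputable section

namespace LogLaplacian

/-! Write p for `profile` and L for `truncLog`, so that p = L^(-1/2) on (0, ∞). The barrier is a
cutoff times p(x₁), and the only delicate part of its logarithmic Laplacian at height t = x₁ is
`coordIntegral`, the integral of (p(t) - p(t + z₁)) / |z|^N over the unit ball. Symmetrising in z
and passing to polar coordinates, where r^(N-1) dr / r^N = dr / r is scale invariant, turns twice
this integral into the average over unit vectors u of the one-dimensional quantity
`secondDiffIntegral` t |u₁| (`two_mul_coordIntegral_eq_sphere`).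

In one dimension, the range s < t/2 contributes O(p(t)) because p is sublinear. For s > t/2 the
second difference may be replaced by 2p(t) - p(s), again at cost O(p(t))
(`abs_integral_sub_main_le`). Since -2 √L is a primitive of p(s)/s on (0, 1], what remains is
2p(t)(L(t/2) - L(b)) + 2√L(b) - 2√L(t/2). A profile L^(-a) with 0 < a < 1 would leave a multiple 2 -
1/(1-a) of L(t)^(1-a); only a = 1/2 cancels this divergence, and the positive limit 2√L(b) survives
as t tends to 0.

Boundedness on the half ball follows by integrating √L(|u₁|) ≤ |u₁|^(-1/2) over the sphere
(`exists_abs_coordIntegral_le`). Positivity near the origin follows from the cap |u₁| > 1/2, the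
rest of the sphere costing only O(p(t)) (`exists_le_coordIntegral`). The cutoff error has a good
sign where the cutoff is 1, the far integral vanishes there, and the zero-order term is O(p(t)),
which tends to 0. -/

/-! ### The one-dimensional profile: monotonicity, sublinearity, moduli of continuity. -/

/-- The truncated logarithm `max (log 2) (-log (s / 2))`. -/
def truncLog (s : ℝ) : ℝ := max (Real.log 2) (-Real.log (s / 2))

/-- The one-dimensional profile, equal to `(-log (s / 2)) ^ (-1/2)` for `0 < s ≤ 1`. -/
def profile (s : ℝ) : ℝ := if 0 < s then (√(truncLog s))⁻¹ else 0

lemma log_two_bounds : 2 / 3 < Real.log 2 ∧ Real.log 2 < 1 :=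
  ⟨by linarith [Real.log_two_gt_d9], by linarith [Real.log_two_lt_d9]⟩

lemma log_two_le_truncLog (s : ℝ) : Real.log 2 ≤ truncLog s := le_max_left _ _

lemma truncLog_pos (s : ℝ) : 0 < truncLog s :=
  (Real.log_pos one_lt_two).trans_le (log_two_le_truncLog s)

lemma half_le_sqrt_truncLog (s : ℝ) : 1 / 2 ≤ √(truncLog s) :=
  Real.le_sqrt_of_sq_le (by nlinarith [log_two_le_truncLog s, log_two_bounds.1])

lemma truncLog_eq {s : ℝ} (h0 : 0 < s) (h1 : s ≤ 1) : truncLog s = -Real.log (s / 2) := by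
  refine max_eq_right ?_
  rw [Real.log_div h0.ne' two_ne_zero]
  linarith [Real.log_nonpos h0.le h1]

lemma truncLog_anti {s t : ℝ} (h0 : 0 < s) (h : s ≤ t) : truncLog t ≤ truncLog s :=
  max_le_max le_rfl (neg_le_neg (Real.log_le_log (by positivity) (by linarith)))

lemma profile_of_pos {s : ℝ} (h : 0 < s) : profile s = (√(truncLog s))⁻¹ := if_pos h

lemma profile_of_nonpos {s : ℝ} (h : s ≤ 0) : profile s = 0 := if_neg h.not_gt

lemma profile_nonneg (s : ℝ) : 0 ≤ profile s := by
  unfold profile; split_ifs <;> positivity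

lemma profile_pos {s : ℝ} (h : 0 < s) : 0 < profile s := by
  rw [profile_of_pos h]
  exact inv_pos.2 (Real.sqrt_pos.2 (truncLog_pos s))

lemma profile_le_two (s : ℝ) : profile s ≤ 2 := by
  unfold profile
  split_ifs
  · rw [inv_le_comm₀ (Real.sqrt_pos.2 (truncLog_pos s)) two_pos]
    linarith [half_le_sqrt_truncLog s]
  · norm_num

lemma profile_mono : Monotone profile := by
  intro s t h
  rcases le_or_gt s 0 with hs | hs
  · rw [profile_of_nonpos hs]; exact profile_nonneg t
  · rw [profile_of_pos hs, profile_of_pos (hs.trans_le h)]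
    exact inv_anti₀ (Real.sqrt_pos.2 (truncLog_pos t)) (Real.sqrt_le_sqrt (truncLog_anti hs h))

lemma measurable_profile : Measurable profile := profile_mono.measurable

/-- Combines (3/2) log r ≤ r^(3/2) - 1 with the floor log 2 > 2/3 of `truncLog`. After the square
root the profile grows at most like r^(3/4); an exponent below 1 is what makes the tail error in
`abs_integral_sub_main_le` summable. -/
lemma truncLog_le_rpow_mul {s r : ℝ} (hs : 0 < s) (hr : 1 ≤ r) :
    truncLog s ≤ r ^ (3 / 2 : ℝ) * truncLog (r * s) := by
  have hr0 : 0 < r := by linarith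
  have hlog : Real.log r * (3 / 2) ≤ r ^ (3 / 2 : ℝ) - 1 := by
    have := Real.log_le_sub_one_of_pos (Real.rpow_pos_of_pos hr0 (3 / 2))
    rw [Real.log_rpow hr0] at this
    linarith
  have h1 : (1 : ℝ) ≤ r ^ (3 / 2 : ℝ) := Real.one_le_rpow hr (by norm_num)
  have hm := log_two_le_truncLog (r * s)
  have h2 := log_two_bounds.1
  have key : truncLog (r * s) + Real.log r ≤ r ^ (3 / 2 : ℝ) * truncLog (r * s) := by
    nlinarith
  refine max_le ?_ ?_
  · nlinarith [Real.log_pos one_lt_two]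
  · refine le_trans ?_ key
    have : -Real.log (r * s / 2) ≤ truncLog (r * s) := le_max_right _ _
    rw [mul_div_assoc, Real.log_mul hr0.ne' (by positivity)] at this
    linarith

lemma profile_mul_le_rpow {s r : ℝ} (hs : 0 < s) (hr : 1 ≤ r) :
    profile (r * s) ≤ r ^ (3 / 4 : ℝ) * profile s := by
  have hr0 : 0 < r := by linarith
  rw [profile_of_pos hs, profile_of_pos (by positivity)]
  have h := Real.sqrt_le_sqrt (truncLog_le_rpow_mul hs hr)
  rw [Real.sqrt_mul (by positivity), Real.sqrt_eq_rpow (r ^ (3 / 2 : ℝ)),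
    ← Real.rpow_mul hr0.le] at h
  norm_num at h
  have h1 := Real.sqrt_pos.2 (truncLog_pos s)
  have h2 := Real.sqrt_pos.2 (truncLog_pos (r * s))
  rw [← div_eq_mul_inv, le_div_iff₀ h1, inv_mul_le_iff₀ h2]
  linarith

lemma profile_mul_le {s r : ℝ} (hs : 0 < s) (hr : 1 ≤ r) :
    profile (r * s) ≤ r * profile s := by
  refine (profile_mul_le_rpow hs hr).trans (mul_le_mul_of_nonneg_right ?_ (profile_nonneg s))
  exact (Real.rpow_le_rpow_of_exponent_le hr (by norm_num)).trans_eq (Real.rpow_one r)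

lemma profile_add_sub_le {s h : ℝ} (hs : 0 < s) (hh : 0 ≤ h) :
    profile (s + h) - profile s ≤ h / s * profile s := by
  have := profile_mul_le (r := 1 + h / s) hs (by linarith [div_nonneg hh hs.le])
  rw [show (1 + h / s) * s = s + h by field_simp] at this
  linarith

/-- Upward steps and downward steps of length at most t/2 use sublinearity, from a base point at
least t/2, whence the factor 2. For longer downward steps 2|z|/t is already at least 1 and p(t)
itself is a bound. -/
lemma abs_profile_sub_le {t : ℝ} (ht : 0 < t) (z : ℝ) :
    |profile t - profile (t + z)| ≤ 2 * |z| / t * profile t := by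
  have hp := profile_nonneg t
  rcases le_or_gt 0 z with hz | hz
  · rw [abs_sub_comm, abs_of_nonneg (sub_nonneg.2 (profile_mono (by linarith))), abs_of_nonneg hz]
    refine (profile_add_sub_le ht hz).trans (mul_le_mul_of_nonneg_right ?_ hp)
    gcongr; linarith
  · rw [abs_of_nonneg (sub_nonneg.2 (profile_mono (by linarith))), abs_of_neg hz]
    rcases le_or_gt (-z) (t / 2) with h | h
    · have h1 := profile_add_sub_le (s := t + z) (h := -z) (by linarith) (by linarith)
      rw [show t + z + -z = t by ring] at h1
      refine h1.trans (mul_le_mul ?_ (profile_mono (by linarith)) (profile_nonneg _) ?_)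
      · rw [div_le_div_iff₀ (by linarith) ht]; nlinarith
      · exact div_nonneg (by linarith) ht.le
    · have : 1 ≤ 2 * -z / t := by rw [le_div_iff₀ ht]; linarith
      nlinarith [profile_nonneg (t + z)]

lemma abs_profile_sub_le_profile (a b : ℝ) :
    |profile a - profile b| ≤ 2 * profile |a - b| := by
  wlog h : b ≤ a generalizing a b
  · rw [abs_sub_comm, abs_sub_comm a b]; exact this b a (le_of_not_ge h)
  rw [abs_of_nonneg (sub_nonneg.2 (profile_mono h)), abs_of_nonneg (sub_nonneg.2 h)]
  rcases h.eq_or_lt with rfl | hlt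
  · simp [profile_nonneg]
  have hd : 0 < a - b := sub_pos.2 hlt
  have hn := profile_nonneg (a - b)
  rcases le_or_gt b 0 with hb | hb
  · have := profile_mono (show a - b ≥ a by linarith)
    linarith [profile_nonneg b]
  rcases le_or_gt b (a - b) with hb2 | hb2
  · have h1 := profile_mono (show a ≤ 2 * (a - b) by linarith)
    linarith [profile_nonneg b, profile_mul_le (r := 2) hd (by norm_num)]
  · have h1 := profile_add_sub_le hb hd.le
    rw [add_sub_cancel] at h1
    have h2 := profile_mul_le (r := b / (a - b)) hd (by rw [le_div_iff₀ hd]; linarith)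
    rw [div_mul_cancel₀ _ hd.ne'] at h2
    -- This is the monotonicity of p(s)/s, used here with a - b < b.
    have h3 : (a - b) / b * profile b ≤ profile (a - b) := by
      rw [div_mul_eq_mul_div, div_le_iff₀ hb]
      calc (a - b) * profile b ≤ (a - b) * (b / (a - b) * profile (a - b)) := by gcongr
        _ = _ := by field_simp
    linarith

/-- Trades pointwise Lipschitz control for a bound integrable in t near 0 and still of positive
order in z; it serves the energy estimate `memH_barrier`. -/
lemma abs_profile_sub_le_sqrt {t : ℝ} (ht : t ≠ 0) (z : ℝ) :
    |profile t - profile (t + z)| ≤ 4 * (√|z| * (√|t|)⁻¹) := by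
  rw [← div_eq_mul_inv, ← Real.sqrt_div (abs_nonneg z)]
  have h2 : |profile t - profile (t + z)| ≤ 2 := by
    rw [abs_sub_le_iff]
    constructor <;>
      linarith [profile_nonneg t, profile_nonneg (t + z), profile_le_two t, profile_le_two (t + z)]
  have hta : 0 < |t| := abs_pos.2 ht
  rcases le_or_gt |t| |z| with h | h
  · have : 1 ≤ √(|z| / |t|) := Real.one_le_sqrt.2 ((one_le_div hta).2 h)
    linarith
  · have hr : |z| / |t| ≤ 1 := (div_le_one hta).2 h.le
    have hs : |z| / |t| ≤ √(|z| / |t|) := Real.le_sqrt_of_sq_le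
      (by nlinarith [div_nonneg (abs_nonneg z) hta.le])
    rcases lt_or_gt_of_ne ht with hn | hp
    · rw [abs_of_neg hn] at h
      rw [profile_of_nonpos hn.le, profile_of_nonpos (by linarith [le_abs_self z]), sub_zero, abs_zero]
      positivity
    · rw [abs_of_pos hp] at hs ⊢
      refine (abs_profile_sub_le hp z).trans ?_
      have := profile_le_two t
      have h0 : 0 ≤ |z| / t := by positivity
      rw [mul_div_assoc]
      nlinarith

/-- Lets the profile absorb the bounded Lipschitz variation of the cutoff. -/
lemma min_one_le_profile {r : ℝ} (hr : 0 < r) : min 1 r ≤ profile r := by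
  have h1 : 1 ≤ profile 1 := by
    rw [profile_of_pos one_pos, truncLog_eq one_pos le_rfl, one_div, Real.log_inv, neg_neg]
    refine (one_le_inv₀ (Real.sqrt_pos.2 (Real.log_pos one_lt_two))).2 ?_
    exact Real.sqrt_le_one.2 log_two_bounds.2.le
  rcases le_total 1 r with h | h
  · rw [min_eq_left h]; exact h1.trans (profile_mono h)
  · rw [min_eq_right h]
    have := profile_mul_le (r := 1 / r) hr (by rw [le_div_iff₀ hr]; linarith)
    rw [one_div_mul_cancel hr.ne', one_div_mul_eq_div, le_div_iff₀ hr] at this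
    nlinarith

/-! ### Comparison of the profile with the square root of `ell`. -/

lemma ell_rpow_half {r : ℝ} (hr : 0 < r) :
    ell r ^ (1 / 2 : ℝ) = (√(max (Real.log 10) (-Real.log r)))⁻¹ := by
  have hm : 0 < min (1 / 10 : ℝ) r := lt_min (by norm_num) hr
  have h1 : -Real.log (min (1 / 10) r) = max (Real.log 10) (-Real.log r) := by
    rcases le_total (1 / 10) r with h | h
    · rw [min_eq_left h, max_eq_left, one_div, Real.log_inv, neg_neg]
      have := Real.log_le_log (by norm_num) h
      rw [one_div, Real.log_inv] at this
      linarith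
    · rw [min_eq_right h, max_eq_right]
      have := Real.log_le_log hr h
      rw [one_div, Real.log_inv] at this
      linarith
  rw [← Real.sqrt_eq_rpow, ell, ← Real.sqrt_inv, ← h1, neg_div, one_div, inv_neg]

lemma profile_le_two_mul_ell {r : ℝ} (hr : 0 < r) :
    profile r ≤ 2 * ell r ^ (1 / 2 : ℝ) := by
  have h10 : Real.log 10 ≤ 4 * Real.log 2 := by
    rw [show (4 : ℝ) * Real.log 2 = Real.log (2 ^ 4) by rw [Real.log_pow]; norm_num]
    exact Real.log_le_log (by norm_num) (by norm_num)
  rw [profile_of_pos hr, ell_rpow_half hr]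
  have h : max (Real.log 10) (-Real.log r) ≤ 4 * truncLog r := by
    have h3 : -Real.log (r / 2) ≤ truncLog r := le_max_right _ _
    rw [Real.log_div hr.ne' two_ne_zero] at h3
    have := log_two_le_truncLog r
    exact max_le (by linarith) (by linarith [truncLog_pos r, Real.log_pos one_lt_two])
  have hs := Real.sqrt_le_sqrt h
  rw [Real.sqrt_mul (by norm_num), show (4 : ℝ) = 2 ^ 2 by norm_num,
    Real.sqrt_sq (by norm_num)] at hs
  have hp : 0 < √(max (Real.log 10) (-Real.log r)) :=
    Real.sqrt_pos.2 (lt_max_of_lt_left (Real.log_pos (by norm_num)))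
  rw [← div_eq_mul_inv, le_div_iff₀ hp, inv_mul_le_iff₀ (Real.sqrt_pos.2 (truncLog_pos r))]
  linarith

lemma ell_rpow_half_bounds_profile {r : ℝ} (hr : 0 < r) (hr1 : r ≤ 1 / 10) :
    (1 / 2) * ell r ^ (1 / 2 : ℝ) < profile r ∧ profile r < 2 * ell r ^ (1 / 2 : ℝ) := by
  have hl : Real.log 10 ≤ -Real.log r := by
    have := Real.log_le_log hr hr1
    rw [one_div, Real.log_inv] at this
    linarith
  have hl2 : Real.log 2 < Real.log 10 := Real.log_lt_log (by norm_num) (by norm_num)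
  have h2 := Real.log_pos one_lt_two
  rw [ell_rpow_half hr, max_eq_right hl, profile_of_pos hr, truncLog_eq hr (by linarith),
    Real.log_div hr.ne' two_ne_zero]
  have hp : 0 < √(-Real.log r) := Real.sqrt_pos.2 (by linarith)
  have hq : 0 < √(-(Real.log r - Real.log 2)) := Real.sqrt_pos.2 (by linarith)
  rw [← div_eq_mul_inv, ← div_eq_mul_inv, div_lt_iff₀ hp, inv_mul_eq_div, lt_div_iff₀ hq,
    lt_div_iff₀ hp, inv_mul_lt_iff₀ hq]
  have e4 : √(4 * -Real.log r) = 2 * √(-Real.log r) := by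
    rw [Real.sqrt_mul (by norm_num), show (4 : ℝ) = 2 ^ 2 by norm_num, Real.sqrt_sq (by norm_num)]
  have ha : √(-(Real.log r - Real.log 2)) < √(4 * -Real.log r) :=
    Real.sqrt_lt_sqrt (by linarith) (by linarith)
  have hb : √(-Real.log r) < √(-(Real.log r - Real.log 2)) :=
    Real.sqrt_lt_sqrt (by linarith) (by linarith)
  constructor <;> linarith

/-! ### One-dimensional asymptotics of the second-difference integral. -/

/-- The symmetric second difference of the profile. -/
def secondDiff (t s : ℝ) : ℝ := 2 * profile t - profile (t + s) - profile (t - s)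

/-- The one-dimensional logarithmic-kernel integral of the second difference. -/
def secondDiffIntegral (t b : ℝ) : ℝ := ∫ s in (0 : ℝ)..b, secondDiff t s / s

lemma measurable_secondDiff (t : ℝ) : Measurable (secondDiff t) := by
  unfold secondDiff
  exact (measurable_const.sub (measurable_profile.comp (by fun_prop))).sub
    (measurable_profile.comp (by fun_prop))

lemma abs_secondDiff_le {t : ℝ} (ht : 0 < t) {s : ℝ} (hs : 0 ≤ s) :
    |secondDiff t s| ≤ 4 * s / t * profile t := by
  have h1 := abs_profile_sub_le ht s
  have h2 := abs_profile_sub_le ht (-s)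
  rw [abs_neg, abs_of_nonneg hs, ← sub_eq_add_neg] at h2
  rw [abs_of_nonneg hs] at h1
  have e : secondDiff t s = (profile t - profile (t + s)) + (profile t - profile (t - s)) := by
    unfold secondDiff; ring
  rw [e]
  refine (abs_add_le _ _).trans ((add_le_add h1 h2).trans_eq ?_)
  ring

lemma abs_secondDiff_div_le {t : ℝ} (ht : 0 < t) {s : ℝ} (hs : 0 ≤ s) :
    |secondDiff t s / s| ≤ 4 / t * profile t := by
  rcases hs.eq_or_lt with rfl | h
  · simp only [div_zero, abs_zero]
    have := profile_nonneg t
    positivity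
  · rw [abs_div, abs_of_pos h, div_le_iff₀ h]
    refine (abs_secondDiff_le ht hs).trans_eq ?_
    ring

lemma intervalIntegrable_secondDiff_div {t : ℝ} (ht : 0 < t) {a b : ℝ} (ha : 0 ≤ a)
    (hab : a ≤ b) : IntervalIntegrable (fun s => secondDiff t s / s) volume a b := by
  rw [intervalIntegrable_iff_integrableOn_Ioc_of_le hab]
  refine Measure.integrableOn_of_bounded (M := 4 / t * profile t) (by simp)
    ((measurable_secondDiff t).div measurable_id).aestronglyMeasurable ?_
  filter_upwards [ae_restrict_mem measurableSet_Ioc] with s hs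
  exact abs_secondDiff_div_le ht (ha.trans hs.1.le)

lemma abs_secondDiffIntegral_le_of_le_half {t : ℝ} (ht : 0 < t) {b : ℝ} (hb : 0 ≤ b)
    (hbt : b ≤ t / 2) : |secondDiffIntegral t b| ≤ 2 * profile t := by
  have h := intervalIntegral.norm_integral_le_of_norm_le_const (a := 0) (b := b)
    (f := fun s => secondDiff t s / s) (C := 4 / t * profile t) (fun s hs => by
      rw [Set.uIoc_of_le hb] at hs
      exact abs_secondDiff_div_le ht hs.1.le)
  rw [sub_zero, abs_of_nonneg hb] at h
  refine h.trans ?_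
  calc 4 / t * profile t * b ≤ 4 / t * profile t * (t / 2) :=
        mul_le_mul_of_nonneg_left hbt (mul_nonneg (by positivity) (profile_nonneg t))
    _ = 2 * profile t := by field_simp; ring

lemma hasDerivAt_two_mul_sqrt_truncLog {s : ℝ} (h0 : 0 < s) (h1 : s ≤ 1) :
    HasDerivAt (fun s => 2 * √(-Real.log (s / 2))) (-(profile s / s)) s := by
  have hl : 0 < -Real.log (s / 2) := truncLog_eq h0 h1 ▸ truncLog_pos s
  have hd : HasDerivAt (fun s : ℝ => -Real.log (s / 2)) (-(1 / 2 / (s / 2))) s :=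
    (((hasDerivAt_id s).div_const 2).log (by simp [h0.ne'])).neg
  refine ((hd.sqrt hl.ne').const_mul 2).congr_deriv ?_
  rw [profile_of_pos h0, truncLog_eq h0 h1]
  have := Real.sqrt_pos.2 hl
  field_simp

lemma continuousOn_profile : ContinuousOn profile (Set.Ioi 0) := by
  have h : ContinuousOn (fun s => (√(truncLog s))⁻¹) (Set.Ioi 0) := by
    refine ContinuousOn.inv₀ (Real.continuous_sqrt.comp_continuousOn ?_)
      fun s _ => (Real.sqrt_pos.2 (truncLog_pos s)).ne'
    refine ContinuousOn.sup continuousOn_const (ContinuousOn.neg ?_)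
    refine ContinuousOn.log (by fun_prop) fun s hs => ?_
    have : (0 : ℝ) < s := hs
    positivity
  exact h.congr fun s hs => profile_of_pos hs

lemma intervalIntegrable_main {t a b : ℝ} (ha : 0 < a) (hab : a ≤ b) :
    IntervalIntegrable (fun s => (2 * profile t - profile s) / s) volume a b := by
  refine ContinuousOn.intervalIntegrable ?_
  rw [Set.uIcc_of_le hab]
  have hp : ∀ s ∈ Set.Icc a b, 0 < s := fun s hs => ha.trans_le hs.1
  exact (continuousOn_const.sub (continuousOn_profile.mono hp)).div continuousOn_id
    fun s hs => (hp s hs).ne'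

lemma integral_main {t a b : ℝ} (ha : 0 < a) (hab : a ≤ b) (hb : b ≤ 1) :
    ∫ s in a..b, (2 * profile t - profile s) / s =
      2 * profile t * (truncLog a - truncLog b) + 2 * √(truncLog b) - 2 * √(truncLog a) := by
  have hb0 := ha.trans_le hab
  have h := intervalIntegral.integral_eq_sub_of_hasDerivAt (a := a) (b := b)
    (f := fun s => 2 * profile t * Real.log s + 2 * √(-Real.log (s / 2)))
    (f' := fun s => (2 * profile t - profile s) / s) (fun s hs => by
      rw [Set.uIcc_of_le hab] at hs
      have hs0 := ha.trans_le hs.1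
      refine (((Real.hasDerivAt_log hs0.ne').const_mul (2 * profile t)).add
        (hasDerivAt_two_mul_sqrt_truncLog hs0 (hs.2.trans hb))).congr_deriv ?_
      ring) (intervalIntegrable_main ha hab)
  rw [h, truncLog_eq ha (hab.trans hb), truncLog_eq hb0 hb,
    Real.log_div ha.ne' two_ne_zero, Real.log_div hb0.ne' two_ne_zero]
  ring

/-- The two numerators differ by p(t + s) - p(s) and p(t - s). The first is at most (t/s) p(s) by
sublinearity; the second vanishes for s ≥ t and is at most p(t) otherwise. -/
lemma secondDiff_div_sub_main {t s : ℝ} (ht : 0 < t) (hs : t / 2 ≤ s) :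
    |secondDiff t s / s - (2 * profile t - profile s) / s| ≤
      2 * t * (2 / t) ^ (3 / 4 : ℝ) * profile t * s ^ (-(5 / 4) : ℝ) := by
  have hs0 : 0 < s := by linarith
  have hr : 1 ≤ 2 / t * s := by rw [div_mul_eq_mul_div, le_div_iff₀ ht]; linarith
  set q := (2 / t * s) ^ (3 / 4 : ℝ) with hq
  have hq1 : 1 ≤ q := Real.one_le_rpow hr (by norm_num)
  have hpt := profile_nonneg t
  have h1 : profile s ≤ q * profile t := by
    have := profile_mul_le_rpow (s := t / 2) (by linarith) hr
    rw [show 2 / t * s * (t / 2) = s by field_simp] at this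
    exact this.trans (mul_le_mul_of_nonneg_left (profile_mono (by linarith)) (by positivity))
  have h2 : |profile (t + s) - profile s| ≤ t / s * (q * profile t) := by
    rw [abs_of_nonneg (sub_nonneg.2 (profile_mono (by linarith))), add_comm t s]
    exact (profile_add_sub_le hs0 ht.le).trans (mul_le_mul_of_nonneg_left h1 (by positivity))
  have h3 : |profile (t - s)| ≤ t / s * (q * profile t) := by
    rw [abs_of_nonneg (profile_nonneg _)]
    rcases le_or_gt s t with h | h
    · have : 1 ≤ t / s := (one_le_div hs0).2 h
      have h4 := profile_mono (show t - s ≤ t by linarith)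
      nlinarith [mul_le_mul_of_nonneg_right hq1 hpt]
    · rw [profile_of_nonpos (by linarith)]
      positivity
  have e : secondDiff t s / s - (2 * profile t - profile s) / s =
      -((profile (t + s) - profile s) + profile (t - s)) / s := by
    unfold secondDiff; ring
  have hsr : s ^ (-(5 / 4) : ℝ) = s ^ (3 / 4 : ℝ) / (s * s) := by
    rw [← sq, ← Real.rpow_natCast, ← Real.rpow_sub hs0]
    norm_num
  rw [e, abs_div, abs_neg, abs_of_pos hs0, div_le_iff₀ hs0]
  refine (abs_add_le _ _).trans ((add_le_add h2 h3).trans_eq ?_)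
  rw [hq, hsr, Real.mul_rpow (by positivity) hs0.le]
  field_simp
  ring

lemma abs_integral_sub_main_le {t b : ℝ} (ht : 0 < t) (hb : t / 2 ≤ b) :
    |(∫ s in (t / 2)..b, secondDiff t s / s) -
      ∫ s in (t / 2)..b, (2 * profile t - profile s) / s| ≤ 16 * profile t := by
  have ha : 0 < t / 2 := by positivity
  have hb0 := ha.trans_le hb
  have hpt := profile_nonneg t
  rw [← intervalIntegral.integral_sub (intervalIntegrable_secondDiff_div ht ha.le hb)
    (intervalIntegrable_main ha hb)]
  have h0 : (0 : ℝ) ∉ Set.uIcc (t / 2) b := by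
    rw [Set.uIcc_of_le hb]; exact fun h => absurd h.1 (by linarith)
  refine (intervalIntegral.norm_integral_le_of_norm_le hb
    (f := fun s => secondDiff t s / s - (2 * profile t - profile s) / s)
    (g := fun s => 2 * t * (2 / t) ^ (3 / 4 : ℝ) * profile t * s ^ (-(5 / 4) : ℝ))
    (Eventually.of_forall fun s hs => secondDiff_div_sub_main ht hs.1.le)
    ((intervalIntegral.intervalIntegrable_rpow (Or.inr h0)).const_mul _)).trans ?_
  rw [intervalIntegral.integral_const_mul, integral_rpow (Or.inr ⟨by norm_num, h0⟩)]
  have hbn : 0 ≤ b ^ (-(5 / 4) + 1 : ℝ) := by positivity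
  -- All powers of t cancel, so the error is a multiple of p(t) uniformly in b.
  have hpow : t * (2 / t) ^ (3 / 4 : ℝ) * (t / 2) ^ (-(5 / 4) + 1 : ℝ) = 2 := by
    have e : (2 / t) ^ (3 / 4 : ℝ) = (t / 2) ^ (-(3 / 4) : ℝ) := by
      rw [Real.rpow_neg ha.le, ← Real.inv_rpow ha.le, inv_div]
    rw [e, mul_assoc, ← Real.rpow_add ha]
    norm_num
    rw [Real.rpow_neg_one]
    field_simp
  have hc : 0 ≤ 2 * t * (2 / t) ^ (3 / 4 : ℝ) * profile t := by positivity
  calc 2 * t * (2 / t) ^ (3 / 4 : ℝ) * profile t *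
        ((b ^ (-(5 / 4) + 1 : ℝ) - (t / 2) ^ (-(5 / 4) + 1 : ℝ)) / (-(5 / 4) + 1))
      ≤ 2 * t * (2 / t) ^ (3 / 4 : ℝ) * profile t * (4 * (t / 2) ^ (-(5 / 4) + 1 : ℝ)) := by
        refine mul_le_mul_of_nonneg_left ?_ hc
        rw [show (-(5 / 4) + 1 : ℝ) = -(1 / 4) by norm_num] at hbn ⊢
        linarith
    _ = 8 * (t * (2 / t) ^ (3 / 4 : ℝ) * (t / 2) ^ (-(5 / 4) + 1 : ℝ)) * profile t := by ring
    _ = 16 * profile t := by rw [hpow]; ring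

/-- The leading part of `secondDiffIntegral t b` for `t / 2 ≤ b`. -/
def mainTerm (t b : ℝ) : ℝ :=
  2 * profile t * (truncLog (t / 2) - truncLog b) + 2 * √(truncLog b) - 2 * √(truncLog (t / 2))

lemma abs_secondDiffIntegral_sub_mainTerm_le {t b : ℝ} (ht : 0 < t) (hb : t / 2 ≤ b)
    (hb1 : b ≤ 1) : |secondDiffIntegral t b - mainTerm t b| ≤ 18 * profile t := by
  have ha : 0 < t / 2 := by positivity
  have h1 := abs_secondDiffIntegral_le_of_le_half ht ha.le le_rfl
  have h2 := abs_integral_sub_main_le ht hb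
  rw [integral_main ha hb hb1] at h2
  have h3 : secondDiffIntegral t b = secondDiffIntegral t (t / 2) +
      ∫ s in (t / 2)..b, secondDiff t s / s :=
    (intervalIntegral.integral_add_adjacent_intervals
      (intervalIntegrable_secondDiff_div ht le_rfl ha.le)
      (intervalIntegrable_secondDiff_div ht ha.le hb)).symm
  rw [h3, mainTerm, add_sub_assoc]
  refine (abs_add_le _ _).trans ((add_le_add h1 h2).trans_eq ?_)
  ring

/-- With l = √L(t/2) and β = √L(b), bounding p(t) below by 1/l cancels the terms 2l and leaves 2β(1
- β/l). -/
lemma mainTerm_lower {t b : ℝ} (ht : 0 < t) :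
    2 * √(truncLog b) * (1 - √(truncLog b) / √(truncLog (t / 2))) ≤ mainTerm t b ∨
      b < t / 2 := by
  rcases lt_or_ge b (t / 2) with h | h
  · exact Or.inr h
  left
  have ha : 0 < t / 2 := by positivity
  have hB := Real.sq_sqrt (truncLog_pos b).le
  have hL := Real.sq_sqrt (truncLog_pos (t / 2)).le
  have hp : (√(truncLog (t / 2)))⁻¹ ≤ profile t := by
    rw [← profile_of_pos ha]; exact profile_mono (by linarith)
  have hd : 0 ≤ truncLog (t / 2) - truncLog b := sub_nonneg.2 (truncLog_anti ha h)
  have hl := Real.sqrt_pos.2 (truncLog_pos (t / 2))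
  unfold mainTerm
  set β := √(truncLog b)
  set l := √(truncLog (t / 2))
  rw [← hB, ← hL] at hd ⊢
  have := mul_le_mul_of_nonneg_right hp hd
  have e : l⁻¹ * (l ^ 2 - β ^ 2) = l - β * (β / l) := by field_simp
  rw [e] at this
  linarith

lemma mainTerm_upper {t b : ℝ} (ht : 0 < t) (ht1 : t ≤ 1) :
    mainTerm t b ≤ 2 * √(truncLog b) + 4 := by
  have ha : 0 < t / 2 := by positivity
  have hL : truncLog (t / 2) = truncLog t + Real.log 2 := by
    rw [truncLog_eq ha (by linarith), truncLog_eq ht ht1, Real.log_div ha.ne' two_ne_zero]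
    ring
  have hmono : √(truncLog t) ≤ √(truncLog (t / 2)) :=
    Real.sqrt_le_sqrt (truncLog_anti ha (by linarith))
  have hp : profile t * truncLog (t / 2) ≤ √(truncLog t) + 2 := by
    have h1 : profile t * truncLog t = √(truncLog t) := by
      rw [profile_of_pos ht, inv_mul_eq_div, Real.div_sqrt]
    rw [hL, mul_add, h1]
    nlinarith [profile_le_two t, profile_nonneg t, log_two_bounds.2, log_two_bounds.1]
  have := mul_nonneg (profile_nonneg t) (truncLog_pos b).le
  unfold mainTerm
  linarith

lemma mainTerm_nonneg {t b : ℝ} (ht : 0 < t) (hb : t / 2 ≤ b) : 0 ≤ mainTerm t b := by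
  refine le_trans ?_ ((mainTerm_lower ht).resolve_right hb.not_gt)
  have hl := Real.sqrt_pos.2 (truncLog_pos (t / 2))
  have : √(truncLog b) / √(truncLog (t / 2)) ≤ 1 :=
    (div_le_one hl).2 (Real.sqrt_le_sqrt (truncLog_anti (by positivity) hb))
  exact mul_nonneg (by positivity) (by linarith)

/-- The thresholds give L(b) ≤ 2 log 2 and L(t/2) ≥ 8 log 2, so the ratio of square roots in
`mainTerm_lower` is at most 1/2. -/
lemma half_le_mainTerm {t b : ℝ} (ht : 0 < t) (ht1 : t ≤ 1 / 64) (hb : 1 / 2 ≤ b) :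
    1 / 2 ≤ mainTerm t b := by
  refine le_trans ?_ ((mainTerm_lower ht).resolve_right (by linarith))
  have hl := Real.sqrt_pos.2 (truncLog_pos (t / 2))
  have h4 : 4 * truncLog b ≤ truncLog (t / 2) := by
    have h1 := truncLog_anti (by norm_num) hb
    have h2 := truncLog_anti (t := 1 / 128) (show 0 < t / 2 by linarith) (by linarith)
    rw [truncLog_eq (s := 1 / 2) (by norm_num) (by norm_num)] at h1
    rw [truncLog_eq (s := 1 / 128) (by norm_num) (by norm_num)] at h2
    have e1 : Real.log (1 / 2 / 2) = -(2 * Real.log 2) := by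
      rw [show (1 / 2 / 2 : ℝ) = (2 ^ 2)⁻¹ by norm_num, Real.log_inv, Real.log_pow]; norm_num
    have e2 : Real.log (1 / 128 / 2) = -(8 * Real.log 2) := by
      rw [show (1 / 128 / 2 : ℝ) = (2 ^ 8)⁻¹ by norm_num, Real.log_inv, Real.log_pow]; norm_num
    rw [e1] at h1
    rw [e2] at h2
    linarith
  have hs := Real.sqrt_le_sqrt h4
  rw [Real.sqrt_mul (by norm_num), show (4 : ℝ) = 2 ^ 2 by norm_num,
    Real.sqrt_sq (by norm_num)] at hs
  have : √(truncLog b) / √(truncLog (t / 2)) ≤ 1 / 2 := by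
    rw [div_le_iff₀ hl]; linarith
  nlinarith [half_le_sqrt_truncLog b]

/-- A crude power bound suffices, since |u₁|^(-1/2) is integrable on the sphere. -/
lemma sqrt_truncLog_le {b : ℝ} (h0 : 0 < b) (h1 : b ≤ 1) : √(truncLog b) ≤ (√b)⁻¹ := by
  rw [← Real.sqrt_inv]
  refine Real.sqrt_le_sqrt ?_
  rw [truncLog_eq h0 h1, Real.log_div h0.ne' two_ne_zero]
  have := Real.log_le_sub_one_of_pos (inv_pos.2 h0)
  rw [Real.log_inv] at this
  linarith [log_two_bounds.2]

lemma abs_secondDiffIntegral_le {t b : ℝ} (ht : 0 < t) (ht1 : t ≤ 1) (hb : 0 ≤ b)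
    (hb1 : b ≤ 1) : |secondDiffIntegral t b| ≤ 40 + 2 * (√b)⁻¹ := by
  have hi : 0 ≤ (√b)⁻¹ := by positivity
  have hp := profile_le_two t
  rcases le_or_gt b (t / 2) with h | h
  · linarith [abs_secondDiffIntegral_le_of_le_half ht hb h]
  · have h1 := abs_secondDiffIntegral_sub_mainTerm_le ht h.le hb1
    have h2 := mainTerm_nonneg ht h.le
    have h3 := mainTerm_upper (b := b) ht ht1
    have h4 := sqrt_truncLog_le (by linarith) hb1
    have h5 := abs_sub_abs_le_abs_sub (secondDiffIntegral t b) (mainTerm t b)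
    rw [abs_of_nonneg h2] at h5
    linarith

lemma neg_le_secondDiffIntegral {t b : ℝ} (ht : 0 < t) (hb : 0 ≤ b)
    (hb1 : b ≤ 1) : -(18 * profile t) ≤ secondDiffIntegral t b := by
  rcases le_or_gt b (t / 2) with h | h
  · linarith [neg_le_of_abs_le (abs_secondDiffIntegral_le_of_le_half ht hb h), profile_nonneg t]
  · linarith [neg_le_of_abs_le (abs_secondDiffIntegral_sub_mainTerm_le ht h.le hb1),
      mainTerm_nonneg ht h.le]

lemma half_sub_le_secondDiffIntegral {t b : ℝ} (ht : 0 < t) (ht1 : t ≤ 1 / 64)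
    (hb : 1 / 2 ≤ b) (hb1 : b ≤ 1) : 1 / 2 - 18 * profile t ≤ secondDiffIntegral t b := by
  linarith [neg_le_of_abs_le (abs_secondDiffIntegral_sub_mainTerm_le ht (by linarith) hb1),
    half_le_mainTerm ht ht1 hb]

/-! ### Polar coordinates and homogeneous functions on the sphere. -/

open Metric Set in
lemma integral_volumeIoiPow (n : ℕ) (f : ℝ → ℝ) :
    ∫ r : Ioi (0 : ℝ), f r ∂(Measure.volumeIoiPow n) = ∫ r in Ioi (0 : ℝ), r ^ n * f r := by
  simp only [Measure.volumeIoiPow, ENNReal.ofReal]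
  rw [integral_withDensity_eq_integral_smul,
    integral_subtype_comap measurableSet_Ioi fun a : ℝ ↦ Real.toNNReal (a ^ n) • f a,
    setIntegral_congr_fun measurableSet_Ioi fun x hx ↦ ?_]
  · rw [NNReal.smul_def, Real.coe_toNNReal _ (pow_nonneg hx.out.le _), smul_eq_mul]
  · exact (measurable_subtype_coe.pow_const _).real_toNNReal

section Polar

lemma apply_homeomorphUnitSphereProd {E : Type*} [NormedAddCommGroup E] [NormedSpace ℝ E]
    (f : E → ℝ) (x : ({0}ᶜ : Set E)) :
    f ((homeomorphUnitSphereProd E x).2.1 • (homeomorphUnitSphereProd E x).1.1) = f x := by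
  have hx : ‖(x : E)‖ ≠ 0 := norm_ne_zero_iff.2 x.2
  rw [homeomorphUnitSphereProd_apply_snd_coe, homeomorphUnitSphereProd_apply_fst_coe, smul_smul,
    mul_inv_cancel₀ hx, one_smul]

variable {E : Type*} [NormedAddCommGroup E] [NormedSpace ℝ E] [MeasurableSpace E]
  [BorelSpace E] [FiniteDimensional ℝ E] (μ : Measure E) [μ.IsAddHaarMeasure]

open Metric Set in
lemma integrable_polar {f : E → ℝ} (hf : Integrable f μ) :
    Integrable (fun p : sphere (0 : E) 1 × Ioi (0 : ℝ) => f (p.2.1 • p.1.1))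
      (μ.toSphere.prod (.volumeIoiPow (Module.finrank ℝ E - 1))) := by
  rw [← μ.measurePreserving_homeomorphUnitSphereProd.integrable_comp_emb
    (homeomorphUnitSphereProd E).measurableEmbedding]
  refine Integrable.congr (f := fun x : ({0}ᶜ : Set E) => f x) ?_
    (Eventually.of_forall fun x => (apply_homeomorphUnitSphereProd f x).symm)
  exact (integrableOn_iff_comap_subtypeVal (measurableSet_singleton _).compl).1 hf.integrableOn

open Metric Set in
lemma integrable_radial_integral {f : E → ℝ} (hf : Integrable f μ) :
    Integrable (fun u : sphere (0 : E) 1 => ∫ r in Ioi (0 : ℝ),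
      r ^ (Module.finrank ℝ E - 1) * f (r • (u : E))) μ.toSphere := by
  refine (integrable_polar μ hf).integral_prod_left.congr (Eventually.of_forall fun u => ?_)
  exact integral_volumeIoiPow _ fun r => f (r • (u : E))

open Metric Set in
/-- Integration in polar coordinates. -/
lemma integral_polar [Nontrivial E] {f : E → ℝ} (hf : Integrable f μ) :
    ∫ x, f x ∂μ = ∫ u : sphere (0 : E) 1, (∫ r in Ioi (0 : ℝ),
      r ^ (Module.finrank ℝ E - 1) * f (r • (u : E))) ∂μ.toSphere := by
  calc ∫ x, f x ∂μ = ∫ x : ({0}ᶜ : Set E), f x ∂(μ.comap (↑)) := by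
        rw [integral_subtype_comap (measurableSet_singleton _).compl f, restrict_compl_singleton]
    _ = ∫ x : ({0}ᶜ : Set E), f ((homeomorphUnitSphereProd E x).2.1 •
          (homeomorphUnitSphereProd E x).1.1) ∂(μ.comap (↑)) := by
        simp only [apply_homeomorphUnitSphereProd]
    _ = ∫ p : sphere (0 : E) 1 × Ioi (0 : ℝ), f (p.2.1 • p.1.1)
          ∂(μ.toSphere.prod (.volumeIoiPow (Module.finrank ℝ E - 1))) :=
        μ.measurePreserving_homeomorphUnitSphereProd.integral_comp
          (homeomorphUnitSphereProd E).measurableEmbedding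
          fun p : sphere (0 : E) 1 × Ioi (0 : ℝ) => f (p.2.1 • p.1.1)
    _ = _ := by
        rw [integral_prod _ (integrable_polar μ hf)]
        exact integral_congr_ae (Eventually.of_forall fun u =>
          integral_volumeIoiPow _ fun r => f (r • (u : E)))

open Metric Set in
/-- A positively homogeneous function that is integrable on the unit ball
is integrable on the sphere. -/
lemma integrable_toSphere_of_homogeneous {f : E → ℝ} {h : ℝ → ℝ}
    (hh : ∀ r, 0 < r → h r ≠ 0) (hfh : ∀ r, 0 < r → ∀ x, f (r • x) = h r * f x)
    (hf : IntegrableOn f (ball 0 1) μ) :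
    Integrable (fun u : sphere (0 : E) 1 => f u) μ.toSphere := by
  have hgi := integrable_polar μ ((integrable_indicator_iff measurableSet_ball).2 hf)
  have hpos : Measure.volumeIoiPow (Module.finrank ℝ E - 1) (Iio ⟨1, mem_Ioi.2 one_pos⟩) ≠ 0 := by
    rw [Measure.volumeIoiPow_apply_Iio]
    simp only [one_pow, ne_eq, ENNReal.ofReal_eq_zero, not_le]
    positivity
  -- Fubini gives integrability on almost every sphere; as radii below 1 have positive measure, one
  -- such sphere exists, and homogeneity rescales it to the unit sphere.
  obtain ⟨r, hr, hri⟩ : ∃ r : Ioi (0 : ℝ), r ∈ Iio (⟨1, mem_Ioi.2 one_pos⟩ : Ioi (0 : ℝ)) ∧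
      Integrable (fun u : sphere (0 : E) 1 => (ball 0 1).indicator f (r.1 • u.1)) μ.toSphere := by
    by_contra! hcon
    exact hpos (measure_mono_null (fun r hr => hcon r hr) hgi.prod_left_ae)
  refine (hri.const_mul (h r)⁻¹).congr (Eventually.of_forall fun u => ?_)
  have hr1 : (r : ℝ) < 1 := hr
  have hmem : (r : ℝ) • (u : E) ∈ ball (0 : E) 1 := by
    rw [mem_ball_zero_iff, norm_smul, norm_eq_of_mem_sphere, mul_one,
      Real.norm_of_nonneg r.2.out.le]
    exact hr1
  simp only [indicator_of_mem hmem, hfh r r.2]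
  rw [inv_mul_cancel_left₀ (hh r r.2)]

end Polar

/-! ### Integrability of the singular weights. -/

lemma integrableOn_inv_sqrt_abs (R : ℝ) :
    IntegrableOn (fun s : ℝ => (√|s|)⁻¹) (Set.Icc (-R) R) := by
  rcases lt_or_ge R 0 with hR | hR
  · simp [Set.Icc_eq_empty_of_lt (show R < -R by linarith)]
  have h0 : IntervalIntegrable (fun s : ℝ => (√|s|)⁻¹) volume 0 R := by
    refine (intervalIntegral.intervalIntegrable_rpow' (r := -(1 / 2))
      (by norm_num)).congr fun s hs => ?_
    rw [Set.uIoc_of_le hR] at hs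
    rw [abs_of_pos hs.1, Real.rpow_neg hs.1.le, Real.sqrt_eq_rpow]
  have h1 : IntervalIntegrable (fun s : ℝ => (√|s|)⁻¹) volume (-R) 0 := by
    have := (IntervalIntegrable.iff_comp_neg (by finiteness)).1 h0
    simp only [abs_neg, neg_zero] at this
    exact this.symm
  rw [integrableOn_Icc_iff_integrableOn_Ioc,
    ← intervalIntegrable_iff_integrableOn_Ioc_of_le (by linarith)]
  exact h1.trans h0

variable {N : ℕ} [NeZero N]

lemma integrableOn_inv_sqrt_abs_coord (R : ℝ) :
    IntegrableOn (fun x : EuclideanSpace ℝ (Fin N) => (√|x 0|)⁻¹) (Metric.ball 0 R) := by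
  -- The ball lies in the cube of half-side R, on which the weight is a product of one-variable
  -- functions.
  let F : Fin N → ℝ → ℝ := fun i => (Set.Icc (-R) R).indicator
    fun s => if i = 0 then (√|s|)⁻¹ else 1
  have hF : ∀ i, Integrable (F i) := by
    intro i
    rw [integrable_indicator_iff measurableSet_Icc]
    by_cases hi : i = 0
    · simpa only [hi, if_true] using integrableOn_inv_sqrt_abs R
    · simp only [hi, if_false]
      exact integrableOn_const (by simp)
  have hprod : Integrable (fun x : EuclideanSpace ℝ (Fin N) => ∏ i, F i (x i)) :=
    ((PiLp.volume_preserving_ofLp (Fin N)).integrable_comp_emb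
      (MeasurableEquiv.toLp 2 (Fin N → ℝ)).symm.measurableEmbedding).2
      (Integrable.fintype_prod hF)
  refine (hprod.integrableOn (s := Metric.ball 0 R)).congr_fun ?_ measurableSet_ball
  intro x hx
  have hmem : ∀ i, x i ∈ Set.Icc (-R) R := fun i => by
    rw [Set.mem_Icc, ← abs_le]
    exact (PiLp.norm_apply_le x i).trans (mem_ball_zero_iff.1 hx).le
  simp only [F, Set.indicator_of_mem (hmem _)]
  rw [Finset.prod_ite_eq' Finset.univ (0 : Fin N) (fun i => (√|x i|)⁻¹)]
  simp

lemma ae_coord_ne_zero : ∀ᵐ x : EuclideanSpace ℝ (Fin N), x 0 ≠ 0 :=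
  (PiLp.volume_preserving_ofLp (Fin N)).quasiMeasurePreserving.ae
    (Measure.ae_eval_ne (fun _ => volume) (0 : Fin N) (0 : ℝ))

lemma nontrivial_euclideanSpace : Nontrivial (EuclideanSpace ℝ (Fin N)) :=
  have : Nonempty (Fin N) := ⟨0⟩
  inferInstance

lemma integrable_sphere_inv_sqrt_abs_coord :
    Integrable (fun u : Metric.sphere (0 : EuclideanSpace ℝ (Fin N)) 1 =>
      (√|(u : EuclideanSpace ℝ (Fin N)) 0|)⁻¹) (volume : Measure _).toSphere := by
  have := nontrivial_euclideanSpace (N := N)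
  refine integrable_toSphere_of_homogeneous (f := fun x : EuclideanSpace ℝ (Fin N) => (√|x 0|)⁻¹)
    volume (h := fun r => (√r)⁻¹)
    (fun r hr => (inv_pos.2 (Real.sqrt_pos.2 hr)).ne') (fun r hr x => ?_)
    (integrableOn_inv_sqrt_abs_coord 1)
  simp only [PiLp.smul_apply, smul_eq_mul]
  rw [abs_mul, abs_of_pos hr, Real.sqrt_mul hr.le, mul_inv]

/-- Powers of the norm above the critical exponent are integrable on balls. -/
lemma integrableOn_rpow_norm_div {a : ℝ} (ha : 0 < a) (R : ℝ) :
    IntegrableOn (fun x : EuclideanSpace ℝ (Fin N) => ‖x‖ ^ a / ‖x‖ ^ N) (Metric.ball 0 R) := by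
  have := nontrivial_euclideanSpace (N := N)
  rw [integrableOn_fun_norm_addHaar volume (f := fun r => r ^ a / r ^ N)]
  rcases le_or_gt R 0 with hR | hR
  · simp [Set.Ioo_eq_empty_of_le hR]
  have h : IntegrableOn (fun r : ℝ => r ^ (a - 1)) (Set.Ioo 0 R) := by
    have := intervalIntegral.intervalIntegrable_rpow' (a := 0) (b := R) (r := a - 1) (by linarith)
    rw [intervalIntegrable_iff_integrableOn_Ioo_of_le hR.le] at this
    exact this
  refine h.congr_fun (fun r hr => ?_) measurableSet_Ioo
  have hN : N - 1 + 1 = N := Nat.sub_add_cancel (Nat.one_le_iff_ne_zero.2 (NeZero.ne N))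
  rw [finrank_euclideanSpace_fin, smul_eq_mul]
  have h0 : r ^ (a - 1) = r ^ a / r := Real.rpow_sub_one hr.1.ne' a
  have h1 : r ^ N = r ^ (N - 1) * r := by rw [← pow_succ, hN]
  have h2 := pow_pos hr.1 (N - 1)
  have h3 := hr.1
  simp only [h0, h1]
  field_simp

lemma measurable_coord : Measurable (fun z : EuclideanSpace ℝ (Fin N) => z 0) := by fun_prop

/-! ### The singular integral as a spherical average: upper and lower bounds. -/

/-- The singular part of the logarithmic Laplacian of `x ↦ profile (x 0)` at height `t`. -/
def coordIntegral (N : ℕ) [NeZero N] (t : ℝ) : ℝ :=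
  ∫ z : EuclideanSpace ℝ (Fin N) in Metric.ball 0 1, (profile t - profile (t + z 0)) / ‖z‖ ^ N

lemma integrableOn_div_norm_pow_of_abs_le_rpow {f : EuclideanSpace ℝ (Fin N) → ℝ}
    (hf : Measurable f) {C a : ℝ} (ha : 0 < a) (hC : ∀ z, |f z| ≤ C * ‖z‖ ^ a) (R : ℝ) :
    IntegrableOn (fun z => f z / ‖z‖ ^ N) (Metric.ball 0 R) := by
  refine ((integrableOn_rpow_norm_div (N := N) ha R).const_mul C).mono'
    (hf.div (by fun_prop)).aestronglyMeasurable (Eventually.of_forall fun z => ?_)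
  rw [Real.norm_eq_abs, abs_div, abs_of_nonneg (by positivity : 0 ≤ ‖z‖ ^ N), ← mul_div_assoc]
  exact div_le_div_of_nonneg_right (hC z) (by positivity)

lemma abs_profile_sub_coord_le {t : ℝ} (ht : 0 < t) (z : EuclideanSpace ℝ (Fin N)) :
    |profile t - profile (t + z 0)| ≤ 2 / t * profile t * ‖z‖ := by
  refine (abs_profile_sub_le ht (z 0)).trans ?_
  have h1 : |z 0| ≤ ‖z‖ := PiLp.norm_apply_le z 0
  have := profile_nonneg t
  calc 2 * |z 0| / t * profile t = 2 / t * profile t * |z 0| := by ring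
    _ ≤ _ := by gcongr

lemma integrableOn_coordIntegral {t : ℝ} (ht : 0 < t) (R : ℝ) :
    IntegrableOn (fun z : EuclideanSpace ℝ (Fin N) => (profile t - profile (t + z 0)) / ‖z‖ ^ N)
      (Metric.ball 0 R) := by
  refine integrableOn_div_norm_pow_of_abs_le_rpow
    (measurable_const.sub (measurable_profile.comp (by fun_prop))) one_pos
    (C := 2 / t * profile t) (fun z => ?_) R
  rw [Real.rpow_one]
  exact abs_profile_sub_coord_le ht z

lemma setIntegral_ball_comp_neg {N : ℕ} (f : EuclideanSpace ℝ (Fin N) → ℝ) (R : ℝ) :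
    ∫ z in Metric.ball 0 R, f (-z) = ∫ z in Metric.ball 0 R, f z := by
  rw [← integral_indicator measurableSet_ball, ← integral_indicator measurableSet_ball,
    ← integral_neg_eq_self]
  refine integral_congr_ae (Eventually.of_forall fun z => ?_)
  simp [Set.indicator]

lemma secondDiff_even (t s : ℝ) : secondDiff t |s| = secondDiff t s := by
  rcases abs_choice s with h | h <;> rw [h]
  unfold secondDiff
  rw [sub_neg_eq_add, ← sub_eq_add_neg]
  ring

lemma integrableOn_secondDiff {t : ℝ} (ht : 0 < t) :
    IntegrableOn (fun z : EuclideanSpace ℝ (Fin N) => secondDiff t (z 0) / ‖z‖ ^ N)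
      (Metric.ball 0 1) := by
  refine integrableOn_div_norm_pow_of_abs_le_rpow
    ((measurable_secondDiff t).comp measurable_coord) one_pos
    (C := 4 / t * profile t) (fun z => ?_) 1
  rw [Real.rpow_one, Function.comp_apply, ← secondDiff_even]
  refine (abs_secondDiff_le ht (abs_nonneg _)).trans ?_
  have h1 : |z 0| ≤ ‖z‖ := PiLp.norm_apply_le z 0
  have := profile_nonneg t
  calc 4 * |z 0| / t * profile t = 4 / t * profile t * |z 0| := by ring
    _ ≤ _ := by gcongr

lemma two_mul_coordIntegral {t : ℝ} (ht : 0 < t) :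
    2 * coordIntegral N t =
      ∫ z : EuclideanSpace ℝ (Fin N) in Metric.ball 0 1, secondDiff t (z 0) / ‖z‖ ^ N := by
  have h := setIntegral_ball_comp_neg
    (fun z : EuclideanSpace ℝ (Fin N) => (profile t - profile (t + z 0)) / ‖z‖ ^ N) 1
  have hint : IntegrableOn (fun z : EuclideanSpace ℝ (Fin N) =>
      (profile t - profile (t + (-z) 0)) / ‖-z‖ ^ N) (Metric.ball 0 1) := by
    refine ((integrableOn_secondDiff (N := N) ht).sub
      (integrableOn_coordIntegral (N := N) ht 1)).congr (Eventually.of_forall fun z => ?_)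
    simp only [Pi.sub_apply, norm_neg, PiLp.neg_apply, ← sub_eq_add_neg]
    unfold secondDiff; ring
  rw [two_mul, coordIntegral]
  nth_rw 1 [← h]
  rw [← integral_add hint (integrableOn_coordIntegral ht 1)]
  refine integral_congr_ae (Eventually.of_forall fun z => ?_)
  simp only [norm_neg, PiLp.neg_apply, ← sub_eq_add_neg]
  unfold secondDiff; ring

/-- Scale invariance of dr/r; when a = 0 both sides vanish because the second difference at 0 is
zero. -/
lemma integral_secondDiff_scaled (t : ℝ) {a : ℝ} (ha : 0 ≤ a) :
    ∫ r in (0 : ℝ)..1, secondDiff t (r * a) / r = secondDiffIntegral t a := by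
  rcases ha.eq_or_lt with rfl | ha
  · have h0 : secondDiff t 0 = 0 := by unfold secondDiff; simp; ring
    simp [secondDiffIntegral, h0]
  · have h := intervalIntegral.integral_comp_mul_right (a := 0) (b := 1)
      (fun s => secondDiff t s / s) ha.ne'
    rw [zero_mul, one_mul, smul_eq_mul] at h
    rw [secondDiffIntegral, ← mul_inv_cancel_left₀ ha.ne' (∫ s in (0 : ℝ)..a, _), ← h,
      ← intervalIntegral.integral_const_mul]
    refine intervalIntegral.integral_congr fun r _ => ?_
    rw [mul_comm r a, ← div_div, mul_div_assoc', mul_div_cancel₀]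
    exact ha.ne'

lemma radial_integral_secondDiff (t : ℝ) (u : Metric.sphere (0 : EuclideanSpace ℝ (Fin N)) 1) :
    ∫ r in Set.Ioi (0 : ℝ), r ^ (Module.finrank ℝ (EuclideanSpace ℝ (Fin N)) - 1) *
      (Metric.ball 0 1).indicator (fun z : EuclideanSpace ℝ (Fin N) =>
        secondDiff t (z 0) / ‖z‖ ^ N) (r • (u : EuclideanSpace ℝ (Fin N))) =
      secondDiffIntegral t |(u : EuclideanSpace ℝ (Fin N)) 0| := by
  rw [← integral_secondDiff_scaled t (abs_nonneg _),
    intervalIntegral.integral_of_le zero_le_one, integral_Ioc_eq_integral_Ioo,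
    ← Set.Ioi_inter_Iio, ← setIntegral_indicator measurableSet_Iio]
  refine setIntegral_congr_fun measurableSet_Ioi fun r hr => ?_
  have hr0 : 0 < r := hr
  have hnorm : ‖r • (u : EuclideanSpace ℝ (Fin N))‖ = r := by
    rw [norm_smul, norm_eq_of_mem_sphere, mul_one, Real.norm_of_nonneg hr0.le]
  have hN : N - 1 + 1 = N := Nat.sub_add_cancel (Nat.one_le_iff_ne_zero.2 (NeZero.ne N))
  rw [finrank_euclideanSpace_fin]
  by_cases h1 : r < 1
  · rw [Set.indicator_of_mem (by rw [mem_ball_zero_iff, hnorm]; exact h1),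
      Set.indicator_of_mem (show r ∈ Set.Iio 1 from h1), hnorm, PiLp.smul_apply, smul_eq_mul,
      ← secondDiff_even, abs_mul, abs_of_pos hr0]
    have h2 : r ^ N = r ^ (N - 1) * r := by rw [← pow_succ, hN]
    have h3 := pow_pos hr0 (N - 1)
    rw [h2]
    field_simp
  · rw [Set.indicator_of_notMem (by rw [mem_ball_zero_iff, hnorm]; exact h1),
      Set.indicator_of_notMem (show r ∉ Set.Iio 1 from h1), mul_zero]

lemma integrable_secondDiffIntegral {t : ℝ} (ht : 0 < t) :
    Integrable (fun u : Metric.sphere (0 : EuclideanSpace ℝ (Fin N)) 1 =>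
      secondDiffIntegral t |(u : EuclideanSpace ℝ (Fin N)) 0|) (volume : Measure _).toSphere := by
  refine (integrable_radial_integral volume ((integrable_indicator_iff measurableSet_ball).2
    (integrableOn_secondDiff (N := N) ht))).congr (Eventually.of_forall fun u => ?_)
  exact radial_integral_secondDiff t u

lemma two_mul_coordIntegral_eq_sphere {t : ℝ} (ht : 0 < t) :
    2 * coordIntegral N t =
      ∫ u : Metric.sphere (0 : EuclideanSpace ℝ (Fin N)) 1,
        secondDiffIntegral t |(u : EuclideanSpace ℝ (Fin N)) 0| ∂(volume : Measure _).toSphere := by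
  have := nontrivial_euclideanSpace (N := N)
  rw [two_mul_coordIntegral ht, ← integral_indicator measurableSet_ball,
    integral_polar volume ((integrable_indicator_iff measurableSet_ball).2
      (integrableOn_secondDiff (N := N) ht))]
  exact integral_congr_ae (Eventually.of_forall fun u => radial_integral_secondDiff t u)

lemma abs_coord_sphere_le_one (u : Metric.sphere (0 : EuclideanSpace ℝ (Fin N)) 1) :
    |(u : EuclideanSpace ℝ (Fin N)) 0| ≤ 1 :=
  (PiLp.norm_apply_le (u : EuclideanSpace ℝ (Fin N)) 0).trans (norm_eq_of_mem_sphere u).le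

variable (N) in
lemma exists_abs_coordIntegral_le :
    ∃ C : ℝ, ∀ t : ℝ, 0 < t → t ≤ 1 → |coordIntegral N t| ≤ C := by
  let B : Metric.sphere (0 : EuclideanSpace ℝ (Fin N)) 1 → ℝ :=
    fun u => 40 + 2 * (√|(u : EuclideanSpace ℝ (Fin N)) 0|)⁻¹
  have hi : Integrable B (volume : Measure _).toSphere :=
    (integrable_const _).add (integrable_sphere_inv_sqrt_abs_coord.const_mul 2)
  refine ⟨∫ u, B u ∂(volume : Measure _).toSphere, fun t ht ht1 => ?_⟩
  have h := norm_integral_le_of_norm_le hi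
    (f := fun u : Metric.sphere (0 : EuclideanSpace ℝ (Fin N)) 1 =>
      secondDiffIntegral t |(u : EuclideanSpace ℝ (Fin N)) 0|) (Eventually.of_forall fun u =>
    abs_secondDiffIntegral_le ht ht1 (abs_nonneg _) (abs_coord_sphere_le_one u))
  rw [← two_mul_coordIntegral_eq_sphere ht, norm_mul, Real.norm_eq_abs, Real.norm_eq_abs,
    abs_two] at h
  linarith [abs_nonneg (coordIntegral N t)]

variable (N) in
lemma exists_le_coordIntegral :
    ∃ c C : ℝ, 0 < c ∧ ∀ t : ℝ, 0 < t → t ≤ 1 / 64 → c - C * profile t ≤ coordIntegral N t := by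
  let σ := (volume : Measure (EuclideanSpace ℝ (Fin N))).toSphere
  -- On these caps the second-difference integral is at least 1/2 - 18 p(t); elsewhere only -18 p(t)
  -- is used.
  let A : Set (Metric.sphere (0 : EuclideanSpace ℝ (Fin N)) 1) :=
    {u | 1 / 2 < |(u : EuclideanSpace ℝ (Fin N)) 0|}
  have hAo : IsOpen A := isOpen_lt continuous_const (by fun_prop)
  have hAne : A.Nonempty := by
    refine ⟨⟨EuclideanSpace.single 0 1, by simp⟩, ?_⟩
    simp only [A, Set.mem_ofPred_eq]
    norm_num
  have hA : 0 < σ.real A := ENNReal.toReal_pos (hAo.measure_ne_zero σ hAne) (measure_ne_top _ _)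
  refine ⟨σ.real A / 4, 9 * σ.real Set.univ, by positivity, fun t ht ht1 => ?_⟩
  have hAm : MeasurableSet A := hAo.measurableSet
  have hi : Integrable (fun u => A.indicator (fun _ => (1 / 2 : ℝ)) u - 18 * profile t) σ :=
    ((integrable_const _).indicator hAm).sub (integrable_const _)
  have h := integral_mono hi (integrable_secondDiffIntegral (N := N) ht) fun u => by
    by_cases hu : u ∈ A
    · simp only [Set.indicator_of_mem hu]
      exact half_sub_le_secondDiffIntegral ht ht1 (le_of_lt hu) (abs_coord_sphere_le_one u)
    · simp only [Set.indicator_of_notMem hu, zero_sub]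
      exact neg_le_secondDiffIntegral ht (abs_nonneg _) (abs_coord_sphere_le_one u)
  rw [← two_mul_coordIntegral_eq_sphere ht, integral_sub ((integrable_const _).indicator hAm)
    (integrable_const _), integral_indicator_const _ hAm, integral_const, smul_eq_mul,
    smul_eq_mul] at h
  linarith

/-! ### Cutoff and translation of integrals. -/

/-- A smooth cutoff function supported in the ball of radius `1/4`. -/
def cutoff (N : ℕ) : ContDiffBump (0 : EuclideanSpace ℝ (Fin N)) :=
  ⟨1 / 8, 1 / 4, by norm_num, by norm_num⟩

lemma cutoff_eq_zero {N : ℕ} {x : EuclideanSpace ℝ (Fin N)} (hx : 1 / 4 ≤ ‖x‖) :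
    cutoff N x = 0 :=
  (cutoff N).zero_of_le_dist (by rwa [dist_zero_right])

lemma cutoff_eq_one {N : ℕ} {x : EuclideanSpace ℝ (Fin N)} (hx : ‖x‖ ≤ 1 / 8) :
    cutoff N x = 1 :=
  (cutoff N).one_of_mem_closedBall (by rwa [mem_closedBall_zero_iff])

lemma exists_cutoff_lipschitz (N : ℕ) : ∃ K : ℝ, 0 ≤ K ∧
    ∀ x y : EuclideanSpace ℝ (Fin N), |cutoff N x - cutoff N y| ≤ K * ‖x - y‖ := by
  obtain ⟨K, hK⟩ := ContDiff.lipschitzWith_of_hasCompactSupport (cutoff N).hasCompactSupport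
    ((cutoff N).contDiff (n := 1)) one_ne_zero
  refine ⟨K, K.2, fun x y => ?_⟩
  have := hK.dist_le_mul x y
  rwa [Real.dist_eq, dist_eq_norm] at this

lemma abs_cutoff_sub_le_one {N : ℕ} (x y : EuclideanSpace ℝ (Fin N)) :
    |cutoff N x - cutoff N y| ≤ 1 := by
  rw [abs_sub_le_iff]
  constructor <;> linarith [(cutoff N).nonneg (x := x), (cutoff N).nonneg (x := y),
    (cutoff N).le_one (x := x), (cutoff N).le_one (x := y)]

section Translation

variable {N : ℕ} (x : EuclideanSpace ℝ (Fin N))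

lemma preimage_add_left_ball (R : ℝ) : (x + ·) ⁻¹' Metric.ball x R = Metric.ball 0 R := by
  ext z; simp

lemma preimage_add_left_closedBall (R : ℝ) :
    (x + ·) ⁻¹' Metric.closedBall x R = Metric.closedBall 0 R := by
  ext z; simp

lemma integrableOn_ball_iff_translate (g : EuclideanSpace ℝ (Fin N) → ℝ) (R : ℝ) :
    IntegrableOn g (Metric.ball x R) ↔ IntegrableOn (fun z => g (x + z)) (Metric.ball 0 R) := by
  rw [← preimage_add_left_ball x R]
  exact ((measurePreserving_add_left volume x).integrableOn_comp_preimage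
    (measurableEmbedding_addLeft x)).symm

lemma setIntegral_ball_translate (g : EuclideanSpace ℝ (Fin N) → ℝ) (R : ℝ) :
    ∫ y in Metric.ball x R, g y = ∫ z in Metric.ball 0 R, g (x + z) := by
  rw [← preimage_add_left_ball x R]
  exact ((measurePreserving_add_left volume x).setIntegral_preimage_emb
    (measurableEmbedding_addLeft x) g _).symm

lemma setLIntegral_closedBall_translate (g : EuclideanSpace ℝ (Fin N) → ENNReal) (R : ℝ) :
    ∫⁻ y in Metric.closedBall x R, g y = ∫⁻ z in Metric.closedBall 0 R, g (x + z) := by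
  rw [← preimage_add_left_closedBall x R]
  exact ((measurePreserving_add_left volume x).setLIntegral_comp_preimage_emb
    (measurableEmbedding_addLeft x) g _).symm

end Translation

/-! ### The barrier: regularity, convergence and finite energy. -/

/-- The barrier function `χ(x) (-log (x₁ / 2)) ^ (-1/2)`, extended by zero. -/
def barrier (N : ℕ) [NeZero N] (x : EuclideanSpace ℝ (Fin N)) : ℝ :=
  if 0 < x 0 then cutoff N x * (-Real.log (x 0 / 2)) ^ (-(1 / 2) : ℝ) else 0

lemma coord_le_norm (x : EuclideanSpace ℝ (Fin N)) : x 0 ≤ ‖x‖ :=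
  (le_abs_self _).trans (PiLp.norm_apply_le x 0)

/-- Where the cutoff is nonzero x₁ < 1/4, so the truncation in the profile is inactive; the junk
values of the real power for x₁ ≥ 2 are multiplied by 0. -/
lemma barrier_eq (x : EuclideanSpace ℝ (Fin N)) : barrier N x = cutoff N x * profile (x 0) := by
  rcases le_or_gt (1 / 4) ‖x‖ with h | h
  · simp [barrier, cutoff_eq_zero h]
  · unfold barrier profile
    split_ifs with h0
    · have h1 : x 0 ≤ 1 := (coord_le_norm x).trans (by linarith)
      rw [truncLog_eq h0 h1, Real.rpow_neg (truncLog_eq h0 h1 ▸ (truncLog_pos _).le),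
        Real.sqrt_eq_rpow]
    · rw [mul_zero]

lemma barrier_eq_zero {x : EuclideanSpace ℝ (Fin N)} (hx : 1 / 4 ≤ ‖x‖) : barrier N x = 0 := by
  rw [barrier_eq, cutoff_eq_zero hx, zero_mul]

lemma barrier_nonneg (x : EuclideanSpace ℝ (Fin N)) : 0 ≤ barrier N x := by
  rw [barrier_eq]; exact mul_nonneg (cutoff N).nonneg (profile_nonneg _)

lemma barrier_le_profile (x : EuclideanSpace ℝ (Fin N)) : barrier N x ≤ profile (x 0) := by
  rw [barrier_eq]; exact mul_le_of_le_one_left (profile_nonneg _) (cutoff N).le_one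

lemma barrier_le_two (x : EuclideanSpace ℝ (Fin N)) : barrier N x ≤ 2 :=
  (barrier_le_profile x).trans (profile_le_two _)

lemma abs_barrier_le_two (x : EuclideanSpace ℝ (Fin N)) : |barrier N x| ≤ 2 := by
  rw [abs_of_nonneg (barrier_nonneg x)]; exact barrier_le_two x

lemma measurable_barrier : Measurable (barrier N) := by
  rw [show barrier N = fun x => cutoff N x * profile (x 0) from funext barrier_eq]
  exact (cutoff N).continuous.measurable.mul (measurable_profile.comp measurable_coord)

lemma barrier_eq_zero_of_notMem_halfBall {x : EuclideanSpace ℝ (Fin N)}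
    (hx : x ∉ halfBall N) : barrier N x = 0 := by
  by_cases h : 1 / 4 ≤ ‖x‖
  · exact barrier_eq_zero h
  · exact if_neg fun h0 => hx ⟨mem_ball_zero_iff.2 (by linarith), h0⟩

lemma memLp_barrier (p : ENNReal) : MemLp (barrier N) p volume := by
  have : IsFiniteMeasure (volume.restrict (Metric.ball (0 : EuclideanSpace ℝ (Fin N)) 1)) :=
    isFiniteMeasure_restrict.2 measure_ball_lt_top.ne
  have h : MemLp ((Metric.ball 0 1).indicator (barrier N)) p volume :=
    (memLp_indicator_iff_restrict measurableSet_ball).2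
      (MemLp.of_bound measurable_barrier.aestronglyMeasurable 2
        (Eventually.of_forall abs_barrier_le_two))
  rwa [Set.indicator_eq_self.2] at h
  intro x hx
  by_contra hx1
  rw [mem_ball_zero_iff, not_lt] at hx1
  exact hx (barrier_eq_zero (by linarith))

lemma integrable_barrier : Integrable (barrier N) := memLp_one_iff_integrable.1 (memLp_barrier 1)

lemma barrier_sub (x y : EuclideanSpace ℝ (Fin N)) :
    barrier N x - barrier N y = cutoff N x * (profile (x 0) - profile (y 0)) +
      (cutoff N x - cutoff N y) * profile (y 0) := by
  rw [barrier_eq, barrier_eq]; ring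

lemma abs_barrier_sub_le (x y : EuclideanSpace ℝ (Fin N)) :
    |barrier N x - barrier N y| ≤
      |profile (x 0) - profile (y 0)| + 2 * |cutoff N x - cutoff N y| := by
  rw [barrier_sub]
  refine (abs_add_le _ _).trans (add_le_add ?_ ?_)
  · rw [abs_mul, abs_of_nonneg (cutoff N).nonneg]
    exact mul_le_of_le_one_left (abs_nonneg _) (cutoff N).le_one
  · rw [abs_mul, abs_of_nonneg (profile_nonneg _), mul_comm]
    exact mul_le_mul_of_nonneg_right (profile_le_two _) (abs_nonneg _)

lemma logHolder_barrier : LogHolder (1 / 2) Set.univ (barrier N) := by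
  obtain ⟨K, hK, hL⟩ := exists_cutoff_lipschitz N
  refine ⟨(memLp_barrier ⊤).restrict _, 2 * (2 + 2 * max 1 K), fun x _ y _ hxy => ?_⟩
  have hr : 0 < ‖x - y‖ := norm_sub_pos_iff.2 hxy
  have hell : 0 ≤ ell ‖x - y‖ ^ (1 / 2 : ℝ) := by
    rw [ell_rpow_half hr]; positivity
  refine div_le_of_le_mul₀ hell (by positivity) ?_
  have h1 : |profile (x 0) - profile (y 0)| ≤ 2 * profile ‖x - y‖ := by
    refine (abs_profile_sub_le_profile _ _).trans ?_
    have : |x 0 - y 0| ≤ ‖x - y‖ := PiLp.norm_apply_le (x - y) 0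
    linarith [profile_mono this]
  have h2 : |cutoff N x - cutoff N y| ≤ max 1 K * profile ‖x - y‖ := by
    refine le_trans ?_ (mul_le_mul_of_nonneg_left (min_one_le_profile hr) (by positivity))
    have hm1 : 1 ≤ max 1 K := le_max_left _ _
    rcases le_total 1 ‖x - y‖ with h | h
    · rw [min_eq_left h, mul_one]
      exact (abs_cutoff_sub_le_one x y).trans hm1
    · rw [min_eq_right h]
      exact (hL x y).trans (mul_le_mul_of_nonneg_right (le_max_right _ _) hr.le)
  calc |barrier N x - barrier N y| ≤ (2 + 2 * max 1 K) * profile ‖x - y‖ := by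
        linarith [abs_barrier_sub_le x y]
    _ ≤ (2 + 2 * max 1 K) * (2 * ell ‖x - y‖ ^ (1 / 2 : ℝ)) :=
        mul_le_mul_of_nonneg_left (profile_le_two_mul_ell hr) (by positivity)
    _ = _ := by ring

lemma contDiffOn_barrier : ContDiffOn ℝ ∞ (barrier N) {x | x 0 ≠ 0} := by
  intro x hx
  refine ContDiffAt.contDiffWithinAt ?_
  have hc : Continuous fun y : EuclideanSpace ℝ (Fin N) => y 0 := by fun_prop
  have hcd : ContDiff ℝ ∞ fun y : EuclideanSpace ℝ (Fin N) => y 0 :=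
    (EuclideanSpace.proj (𝕜 := ℝ) (0 : Fin N)).contDiff
  by_cases hx2 : 1 < ‖x‖
  · refine (contDiffAt_const (c := (0 : ℝ))).congr_of_eventuallyEq ?_
    filter_upwards [continuous_norm.continuousAt.eventually (lt_mem_nhds hx2)] with y hy
    exact barrier_eq_zero (by linarith)
  rcases lt_or_gt_of_ne hx with hneg | hpos
  · refine (contDiffAt_const (c := (0 : ℝ))).congr_of_eventuallyEq ?_
    filter_upwards [hc.continuousAt.eventually (gt_mem_nhds hneg)] with y hy
    exact if_neg hy.not_gt
  · have hlog : 0 < -Real.log (x 0 / 2) := by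
      rw [← truncLog_eq hpos ((coord_le_norm x).trans (not_lt.1 hx2))]
      exact truncLog_pos _
    refine ContDiffAt.congr_of_eventuallyEq (f := fun y => cutoff N y *
      (-Real.log (y 0 / 2)) ^ (-(1 / 2) : ℝ)) ?_ ?_
    · refine (cutoff N).contDiffAt.mul (ContDiffAt.rpow_const_of_ne ?_ hlog.ne')
      exact ((hcd.contDiffAt.div_const 2).log (by positivity)).neg
    · filter_upwards [hc.continuousAt.eventually (lt_mem_nhds hpos)] with y hy
      exact if_pos hy

lemma exists_abs_barrier_sub_le {x : EuclideanSpace ℝ (Fin N)} (hx : 0 < x 0) :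
    ∃ C : ℝ, ∀ z, |barrier N x - barrier N (x + z)| ≤ C * ‖z‖ ^ (1 : ℝ) := by
  obtain ⟨K, hK, hL⟩ := exists_cutoff_lipschitz N
  refine ⟨2 / x 0 * profile (x 0) + 2 * K, fun z => ?_⟩
  have h1 := abs_profile_sub_coord_le hx z
  have h2 := hL x (x + z)
  rw [sub_add_cancel_left, norm_neg] at h2
  have h3 := abs_barrier_sub_le x (x + z)
  rw [PiLp.add_apply] at h3
  rw [Real.rpow_one]
  linarith

lemma logLapConverges_barrier {x : EuclideanSpace ℝ (Fin N)} (hx : 0 < x 0) :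
    LogLapConverges (barrier N) x := by
  constructor
  · rw [integrableOn_ball_iff_translate]
    obtain ⟨C, hC⟩ := exists_abs_barrier_sub_le hx
    have h := integrableOn_div_norm_pow_of_abs_le_rpow
      (f := fun z => barrier N x - barrier N (x + z)) (measurable_const.sub (measurable_barrier.comp (by fun_prop))) one_pos hC 1
    simpa only [sub_add_cancel_left, norm_neg] using h
  · refine (integrable_barrier.norm.integrableOn (s := (Metric.ball x 1)ᶜ)).mono'
      (measurable_barrier.div (by fun_prop)).aestronglyMeasurable ?_
    filter_upwards [ae_restrict_mem measurableSet_ball.compl] with y hy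
    rw [Set.mem_compl_iff, Metric.mem_ball, not_lt, dist_comm, dist_eq_norm] at hy
    rw [norm_div, norm_pow, norm_norm]
    exact div_le_self (norm_nonneg _) (one_le_pow₀ hy)

/-- With the moving balls written as indicators on the product space, this is measurability of
integrals depending on a parameter. -/
lemma measurable_logLap_barrier : Measurable (logLap (barrier N)) := by
  have hS : MeasurableSet {p : EuclideanSpace ℝ (Fin N) × EuclideanSpace ℝ (Fin N) |
      dist p.2 p.1 < 1} := measurableSet_lt (by fun_prop) measurable_const
  have hw1 : Measurable fun p : EuclideanSpace ℝ (Fin N) × EuclideanSpace ℝ (Fin N) =>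
      barrier N p.1 := measurable_barrier.comp measurable_fst
  have hw2 : Measurable fun p : EuclideanSpace ℝ (Fin N) × EuclideanSpace ℝ (Fin N) =>
      barrier N p.2 := measurable_barrier.comp measurable_snd
  have hk : Measurable fun p : EuclideanSpace ℝ (Fin N) × EuclideanSpace ℝ (Fin N) =>
      ‖p.1 - p.2‖ ^ N := by fun_prop
  have h1 := (((hw1.sub hw2).div hk).indicator hS).stronglyMeasurable.integral_prod_right'
    (ν := volume)
  have h2 := ((hw2.div hk).indicator hS.compl).stronglyMeasurable.integral_prod_right'
    (ν := volume)
  have e : logLap (barrier N) = fun x => kernelConst N * (∫ y, Set.indicator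
      {p : EuclideanSpace ℝ (Fin N) × EuclideanSpace ℝ (Fin N) | dist p.2 p.1 < 1}
        (fun p => (barrier N p.1 - barrier N p.2) / ‖p.1 - p.2‖ ^ N) (x, y)) -
      kernelConst N * (∫ y, Set.indicator
      {p : EuclideanSpace ℝ (Fin N) × EuclideanSpace ℝ (Fin N) | dist p.2 p.1 < 1}ᶜ
        (fun p => barrier N p.2 / ‖p.1 - p.2‖ ^ N) (x, y)) +
      zeroOrderConst N * barrier N x := by
    funext x
    rw [logLap, ← integral_indicator measurableSet_ball,
      ← integral_indicator measurableSet_ball.compl]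
    rfl
  rw [e]
  exact ((h1.measurable.const_mul (kernelConst N)).sub
    (h2.measurable.const_mul (kernelConst N))).add
    (measurable_barrier.const_mul (zeroOrderConst N))

lemma memH_barrier : MemH (halfBall N) (barrier N) := by
  refine ⟨memLp_barrier 2, ?_, Eventually.of_forall fun x => barrier_eq_zero_of_notMem_halfBall⟩
  obtain ⟨K, hK, hL⟩ := exists_cutoff_lipschitz N
  let D : ENNReal := ∫⁻ z : EuclideanSpace ℝ (Fin N) in Metric.closedBall 0 1,
    ENNReal.ofReal (‖z‖ ^ (1 / 2 : ℝ) / ‖z‖ ^ N)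
  have hD : D < ⊤ := ((integrableOn_rpow_norm_div (N := N) (a := 1 / 2) (by norm_num) 2).mono_set
    (Metric.closedBall_subset_ball (by norm_num))).lintegral_lt_top
  let B : EuclideanSpace ℝ (Fin N) → ℝ := fun x => 8 * (√|x 0|)⁻¹ + 4 * K
  have hB : IntegrableOn B (Metric.ball 0 2) :=
    ((integrableOn_inv_sqrt_abs_coord 2).const_mul 8).add (integrableOn_const (by finiteness))
  have key : ∀ᵐ x : EuclideanSpace ℝ (Fin N), (∫⁻ y in Metric.closedBall x 1,
      ENNReal.ofReal (|barrier N x - barrier N y| ^ 2 / ‖x - y‖ ^ N)) ≤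
        (Metric.ball 0 2).indicator (fun x => ENNReal.ofReal (B x) * D) x := by
    -- The hyperplane x₁ = 0 must be discarded: there the convention 0⁻¹ = 0 makes the weight in `B`
    -- vanish.
    filter_upwards [ae_coord_ne_zero] with x hx
    rw [setLIntegral_closedBall_translate]
    simp only [sub_add_cancel_left, norm_neg]
    by_cases hx2 : x ∈ Metric.ball (0 : EuclideanSpace ℝ (Fin N)) 2
    · rw [Set.indicator_of_mem hx2, ← lintegral_const_mul' _ _ ENNReal.ofReal_ne_top]
      refine setLIntegral_mono' measurableSet_closedBall fun z hz => ?_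
      have hB0 : 0 ≤ B x := by positivity
      rw [← ENNReal.ofReal_mul hB0]
      refine ENNReal.ofReal_le_ofReal ?_
      rw [mem_closedBall_zero_iff] at hz
      rw [← mul_div_assoc]
      refine div_le_div_of_nonneg_right ?_ (by positivity)
      rw [← Real.sqrt_eq_rpow]
      have h1 := abs_profile_sub_le_sqrt hx (z 0)
      have h2 := hL x (x + z)
      have h3 := abs_barrier_sub_le x (x + z)
      rw [sub_add_cancel_left, norm_neg] at h2
      rw [PiLp.add_apply] at h3
      have h4 : √|z 0| ≤ √‖z‖ := Real.sqrt_le_sqrt (PiLp.norm_apply_le z 0)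
      have h5 : ‖z‖ ≤ √‖z‖ := Real.le_sqrt_of_sq_le (by nlinarith [norm_nonneg z])
      have h6 : |barrier N x - barrier N (x + z)| ≤ (4 * (√|x 0|)⁻¹ + 2 * K) * √‖z‖ := by
        have h7 : √|z 0| * (√|x 0|)⁻¹ ≤ √‖z‖ * (√|x 0|)⁻¹ := by gcongr
        have h8 : K * ‖z‖ ≤ K * √‖z‖ := by gcongr
        linarith
      have h9 : |barrier N x - barrier N (x + z)| ≤ 2 := by
        rw [abs_sub_le_iff]
        constructor <;> linarith [barrier_nonneg x, barrier_nonneg (x + z), barrier_le_two x,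
          barrier_le_two (x + z)]
      -- One factor of the square is bounded by 2, so that only |x₁|^(-1/2) appears and not the
      -- non-integrable |x₁|^(-1).
      calc |barrier N x - barrier N (x + z)| ^ 2
          ≤ 2 * ((4 * (√|x 0|)⁻¹ + 2 * K) * √‖z‖) := by
            nlinarith [abs_nonneg (barrier N x - barrier N (x + z))]
        _ = B x * √‖z‖ := by simp only [B]; ring
    · rw [Set.indicator_of_notMem hx2, nonpos_iff_eq_zero]
      rw [mem_ball_zero_iff, not_lt] at hx2
      rw [setLIntegral_congr_fun (g := fun _ => 0) measurableSet_closedBall, lintegral_zero]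
      intro z hz
      rw [mem_closedBall_zero_iff] at hz
      have : 1 ≤ ‖x + z‖ := by
        have := norm_sub_le_norm_add x z
        linarith
      simp only
      rw [barrier_eq_zero (x := x) (by linarith), barrier_eq_zero (x := x + z) (by linarith)]
      simp
  refine (lintegral_mono_ae key).trans_lt ?_
  rw [lintegral_indicator measurableSet_ball, lintegral_mul_const' _ _ hD.ne]
  exact ENNReal.mul_lt_top hB.lintegral_lt_top hD

/-! ### Bounds for the logarithmic Laplacian of the barrier. -/

lemma integrableOn_cutoff_error (x : EuclideanSpace ℝ (Fin N)) :
    IntegrableOn (fun z => (cutoff N x - cutoff N (x + z)) * profile ((x + z) 0) / ‖z‖ ^ N)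
      (Metric.ball 0 1) := by
  obtain ⟨K, hK, hL⟩ := exists_cutoff_lipschitz N
  have hm : Measurable fun z => (cutoff N x - cutoff N (x + z)) * profile ((x + z) 0) :=
    (measurable_const.sub ((cutoff N).continuous.measurable.comp (measurable_const_add x))).mul
      ((measurable_profile.comp measurable_coord).comp (measurable_const_add x))
  refine integrableOn_div_norm_pow_of_abs_le_rpow hm one_pos (C := K * 2) (fun z => ?_) 1
  have h := hL x (x + z)
  rw [sub_add_cancel_left, norm_neg] at h
  rw [abs_mul, abs_of_nonneg (profile_nonneg _), Real.rpow_one, mul_right_comm]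
  exact mul_le_mul h (profile_le_two _) (profile_nonneg _) (by positivity)

lemma integral_inner_eq {x : EuclideanSpace ℝ (Fin N)} (hx : 0 < x 0) :
    ∫ y in Metric.ball x 1, (barrier N x - barrier N y) / ‖x - y‖ ^ N =
      cutoff N x * coordIntegral N (x 0) + ∫ z in Metric.ball 0 1,
        (cutoff N x - cutoff N (x + z)) * profile ((x + z) 0) / ‖z‖ ^ N := by
  rw [setIntegral_ball_translate, coordIntegral, ← integral_const_mul,
    ← integral_add ((integrableOn_coordIntegral hx 1).const_mul _) (integrableOn_cutoff_error x)]
  refine integral_congr_ae (Eventually.of_forall fun z => ?_)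
  simp only [sub_add_cancel_left, norm_neg, barrier_sub, PiLp.add_apply]
  ring

lemma abs_integral_outer_le (x : EuclideanSpace ℝ (Fin N)) :
    |∫ y in (Metric.ball x 1)ᶜ, barrier N y / ‖x - y‖ ^ N| ≤ ∫ y, |barrier N y| := by
  refine (norm_integral_le_of_norm_le (f := fun y => barrier N y / ‖x - y‖ ^ N)
    (g := fun y => |barrier N y|)
    integrable_barrier.abs.integrableOn ?_).trans
      (setIntegral_le_integral integrable_barrier.abs (Eventually.of_forall fun y => abs_nonneg _))
  filter_upwards [ae_restrict_mem measurableSet_ball.compl] with y hy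
  rw [Set.mem_compl_iff, Metric.mem_ball, not_lt, dist_comm, dist_eq_norm] at hy
  rw [norm_div, norm_pow, norm_norm]
  exact div_le_self (norm_nonneg _) (one_le_pow₀ hy)

variable (N) in
lemma exists_abs_logLap_barrier_le :
    ∃ M : ℝ, ∀ x : EuclideanSpace ℝ (Fin N), 0 < x 0 → |logLap (barrier N) x| ≤ M := by
  obtain ⟨K, hK, hL⟩ := exists_cutoff_lipschitz N
  obtain ⟨C, hC⟩ := exists_abs_coordIntegral_le N
  let D : ℝ := ∫ z : EuclideanSpace ℝ (Fin N) in Metric.ball 0 1,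
    K * 2 * (‖z‖ ^ (1 : ℝ) / ‖z‖ ^ N)
  have hC0 : 0 ≤ C := (abs_nonneg _).trans (hC 1 one_pos le_rfl)
  refine ⟨|kernelConst N| * (C + D) + |kernelConst N| * (∫ y, |barrier N y|) +
    |zeroOrderConst N| * 2, fun x hx => ?_⟩
  have h1 : |cutoff N x * coordIntegral N (x 0)| ≤ C := by
    -- The bound on `coordIntegral` needs x₁ ≤ 1; outside the support of the cutoff the term is zero
    -- anyway.
    by_cases hn : 1 / 4 ≤ ‖x‖
    · rw [cutoff_eq_zero hn, zero_mul, abs_zero]; exact hC0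
    · rw [abs_mul, abs_of_nonneg (cutoff N).nonneg]
      exact (mul_le_of_le_one_left (abs_nonneg _) (cutoff N).le_one).trans
        (hC _ hx ((coord_le_norm x).trans (by linarith)))
  have h2 : |∫ z in Metric.ball 0 1,
      (cutoff N x - cutoff N (x + z)) * profile ((x + z) 0) / ‖z‖ ^ N| ≤ D := by
    refine norm_integral_le_of_norm_le
      (f := fun z => (cutoff N x - cutoff N (x + z)) * profile ((x + z) 0) / ‖z‖ ^ N)
      (g := fun z => K * 2 * (‖z‖ ^ (1 : ℝ) / ‖z‖ ^ N)) ((integrableOn_rpow_norm_div one_pos 1).const_mul _)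
      (Eventually.of_forall fun z => ?_)
    have h := hL x (x + z)
    rw [sub_add_cancel_left, norm_neg] at h
    rw [Real.norm_eq_abs, abs_div, abs_of_nonneg (by positivity : 0 ≤ ‖z‖ ^ N), ← mul_div_assoc,
      abs_mul, abs_of_nonneg (profile_nonneg _), Real.rpow_one, mul_right_comm]
    exact div_le_div_of_nonneg_right
      (mul_le_mul h (profile_le_two _) (profile_nonneg _) (by positivity)) (by positivity)
  rw [logLap, integral_inner_eq hx]
  refine (abs_add_le _ _).trans (add_le_add ((abs_sub _ _).trans (add_le_add ?_ ?_)) ?_)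
  · rw [abs_mul]
    exact mul_le_mul_of_nonneg_left ((abs_add_le _ _).trans (add_le_add h1 h2)) (abs_nonneg _)
  · rw [abs_mul]
    exact mul_le_mul_of_nonneg_left (abs_integral_outer_le x) (abs_nonneg _)
  · rw [abs_mul]
    exact mul_le_mul_of_nonneg_left (abs_barrier_le_two x) (abs_nonneg _)

lemma memLp_logLap_barrier : MemLp (logLap (barrier N)) ⊤ (volume.restrict (halfBall N)) := by
  obtain ⟨M, hM⟩ := exists_abs_logLap_barrier_le N
  have hmeas : MeasurableSet (halfBall N) :=
    measurableSet_ball.inter (measurableSet_lt measurable_const measurable_coord)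
  refine memLp_top_of_bound measurable_logLap_barrier.aestronglyMeasurable M ?_
  filter_upwards [ae_restrict_mem hmeas] with x hx
  exact hM x hx.2

lemma barrier_eq_profile {x : EuclideanSpace ℝ (Fin N)} (hx : ‖x‖ ≤ 1 / 8) :
    barrier N x = profile (x 0) := by
  rw [barrier_eq, cutoff_eq_one hx, one_mul]

lemma kernelConst_pos : 0 < kernelConst N := by
  have hN : (0 : ℝ) < N := Nat.cast_pos.2 (Nat.pos_of_ne_zero (NeZero.ne N))
  exact mul_pos (Real.rpow_pos_of_pos Real.pi_pos _) (Real.Gamma_pos_of_pos (by positivity))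

/-- Here the cutoff equals its maximum 1 at x, so its error term is nonnegative and can be dropped.
Points at distance at least 1 from x have norm at least 7/8, outside the support, so the far
integral is zero. -/
lemma logLap_barrier_ge {x : EuclideanSpace ℝ (Fin N)} (hx : 0 < x 0) (hx8 : ‖x‖ ≤ 1 / 8) :
    kernelConst N * coordIntegral N (x 0) - |zeroOrderConst N| * profile (x 0) ≤
      logLap (barrier N) x := by
  have hout : ∫ y in (Metric.ball x 1)ᶜ, barrier N y / ‖x - y‖ ^ N = 0 := by
    refine setIntegral_eq_zero_of_forall_eq_zero fun y hy => ?_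
    rw [Set.mem_compl_iff, Metric.mem_ball, not_lt, dist_eq_norm] at hy
    rw [barrier_eq_zero (by linarith [norm_sub_le y x]), zero_div]
  have hin : coordIntegral N (x 0) ≤
      ∫ y in Metric.ball x 1, (barrier N x - barrier N y) / ‖x - y‖ ^ N := by
    rw [integral_inner_eq hx, cutoff_eq_one hx8, one_mul]
    refine le_add_of_nonneg_right (integral_nonneg fun z => ?_)
    exact div_nonneg (mul_nonneg (sub_nonneg.2 (cutoff N).le_one) (profile_nonneg _))
      (by positivity)
  rw [barrier_eq_profile hx8] at hin
  rw [logLap, hout, barrier_eq_profile hx8]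
  have h1 := mul_le_mul_of_nonneg_left hin (kernelConst_pos (N := N)).le
  have h2 := mul_le_mul_of_nonneg_right (neg_abs_le (zeroOrderConst N)) (profile_nonneg (x 0))
  linarith

lemma exists_profile_lt {η : ℝ} (hη : 0 < η) : ∃ δ > 0, ∀ t < δ, profile t < η := by
  refine ⟨2 * Real.exp (-(η⁻¹ ^ 2)), by positivity, fun t ht => ?_⟩
  rcases le_or_gt t 0 with h0 | h0
  · rwa [profile_of_nonpos h0]
  rw [profile_of_pos h0, inv_lt_comm₀ (Real.sqrt_pos.2 (truncLog_pos t)) hη]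
  refine Real.lt_sqrt_of_sq_lt (lt_of_lt_of_le ?_ (le_max_right _ _))
  have := Real.log_lt_log (by positivity) (show t / 2 < Real.exp (-(η⁻¹ ^ 2)) by linarith)
  rw [Real.log_exp] at this
  linarith

variable (N) in
lemma exists_barrier_bounds : ∃ c : ℝ, 0 < c ∧ ∃ δ : ℝ, 0 < δ ∧
    ∀ x ∈ halfBall N ∩ Metric.ball 0 δ,
      c * ell (x 0) ^ (1 / 2 : ℝ) < barrier N x ∧
      barrier N x < c⁻¹ * ell (x 0) ^ (1 / 2 : ℝ) ∧
      c < logLap (barrier N) x := by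
  obtain ⟨c₀, C, hc₀, hJ⟩ := exists_le_coordIntegral N
  set k := kernelConst N with hk
  have hk0 : 0 < k := kernelConst_pos
  set A := k * |C| + |zeroOrderConst N| with hA
  have hA0 : 0 ≤ A := by positivity
  -- All negative terms together are at most A p(x₁), which this choice keeps below half of k c₀;
  -- the +1 keeps the denominator positive.
  obtain ⟨δ, hδ, hp⟩ := exists_profile_lt (η := k * c₀ / (2 * (A + 1))) (by positivity)
  refine ⟨min (1 / 2) (k * c₀ / 2), by positivity, min δ (1 / 64), by positivity, ?_⟩
  rintro x ⟨⟨-, hx0⟩, hx⟩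
  have hx0 : 0 < x 0 := hx0
  rw [mem_ball_zero_iff, lt_min_iff] at hx
  have hcn := coord_le_norm x
  have hb := ell_rpow_half_bounds_profile hx0 (by linarith)
  have hell : 0 ≤ ell (x 0) ^ (1 / 2 : ℝ) := by
    rw [ell_rpow_half hx0]; positivity
  rw [barrier_eq_profile (by linarith)]
  have hc : 0 < min (1 / 2) (k * c₀ / 2) := by positivity
  refine ⟨lt_of_le_of_lt (mul_le_mul_of_nonneg_right (min_le_left _ _) hell) hb.1,
    lt_of_lt_of_le hb.2 (mul_le_mul_of_nonneg_right ?_ hell), ?_⟩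
  · rw [le_inv_comm₀ two_pos hc]
    exact (min_le_left _ _).trans_eq (by norm_num)
  · refine (min_le_right _ _).trans_lt
      (lt_of_lt_of_le ?_ (logLap_barrier_ge hx0 (by linarith)))
    have h1 := mul_le_mul_of_nonneg_left (hJ (x 0) hx0 (by linarith)) hk0.le
    have h2 := hp (x 0) (by linarith)
    rw [lt_div_iff₀ (by positivity)] at h2
    have h3 := profile_pos hx0
    have h4 : k * (C * profile (x 0)) ≤ k * |C| * profile (x 0) := by
      rw [mul_assoc]
      exact mul_le_mul_of_nonneg_left (mul_le_mul_of_nonneg_right (le_abs_self C) h3.le) hk0.le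
    have h5 : A * profile (x 0) = k * |C| * profile (x 0) +
        |zeroOrderConst N| * profile (x 0) := by rw [hA]; ring
    rw [← hk]
    nlinarith

end LogLaplacian

end

theorem theorem2p1 (N : ℕ) [NeZero N] :
    ∃ w : EuclideanSpace ℝ (Fin N) → ℝ,
      LogLaplacian.LogHolder (1 / 2) Set.univ w ∧
      ContDiffOn ℝ ∞ w {x | x 0 ≠ 0} ∧
      LogLaplacian.MemH (LogLaplacian.halfBall N) w ∧
      (∀ x, x ∉ LogLaplacian.halfBall N → w x = 0) ∧
      (∀ x ∈ LogLaplacian.halfBall N, LogLaplacian.LogLapConverges w x) ∧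
      MemLp (LogLaplacian.logLap w) ⊤ (volume.restrict (LogLaplacian.halfBall N)) ∧
      (∃ c : ℝ, 0 < c ∧ ∃ δ : ℝ, 0 < δ ∧
        ∀ x ∈ LogLaplacian.halfBall N ∩ Metric.ball 0 δ,
          c * LogLaplacian.ell (x 0) ^ (1 / 2 : ℝ) < w x ∧
          w x < c⁻¹ * LogLaplacian.ell (x 0) ^ (1 / 2 : ℝ) ∧
          c < LogLaplacian.logLap w x) ∧
      (∃ χ : EuclideanSpace ℝ (Fin N) → ℝ,
        ContDiff ℝ ∞ χ ∧ (∀ x, 0 ≤ χ x ∧ χ x ≤ 1) ∧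
        tsupport χ ⊆ Metric.ball 0 2 ∧ (∀ᶠ x in 𝓝 0, χ x = 1) ∧
        ∀ x, w x = if 0 < x 0 then χ x * (-Real.log (x 0 / 2)) ^ (-(1 / 2) : ℝ) else 0) := by
  refine ⟨LogLaplacian.barrier N, LogLaplacian.logHolder_barrier,
    LogLaplacian.contDiffOn_barrier, LogLaplacian.memH_barrier,
    fun x => LogLaplacian.barrier_eq_zero_of_notMem_halfBall,
    fun x hx => LogLaplacian.logLapConverges_barrier hx.2,
    LogLaplacian.memLp_logLap_barrier, LogLaplacian.exists_barrier_bounds N,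
    LogLaplacian.cutoff N, (LogLaplacian.cutoff N).contDiff,
    fun x => ⟨(LogLaplacian.cutoff N).nonneg, (LogLaplacian.cutoff N).le_one⟩, ?_,
    (LogLaplacian.cutoff N).eventuallyEq_one, fun x => rfl⟩
  rw [(LogLaplacian.cutoff N).tsupport_eq]
  exact Metric.closedBall_subset_ball
    (by rw [show (LogLaplacian.cutoff N).rOut = 1 / 4 from rfl]; norm_num)
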